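/- For $d\ge 1$ and $\varphi\in L^2(\mathbb R^d)$ (complex-valued) let $\widehat\varphi$ denote the Fourier--Plancherel transform, normalised by $\widehat\varphi(\xi)=\int_{\mathbb R^d}\varphi(t)e^{-2i\pi\langle t,\xi\rangle}\,dt$ for $\varphi\in L^1\cap L^2$, and for $s\ge 0$ put $$\|\varphi\|_{H^s}=\Bigl(\int_{\mathbb R^d}|\widehat\varphi(\xi)|^2(1+|\xi|^2)^s\,d\xi\Bigr)^{1/2}\in[0,\infty],\qquad H^s(\mathbb R^d)=\{\varphi\in L^2(\mathbb R^d):\|\varphi\|_{H^s}<\infty\}.$$ For a set $E\subset\mathbb R^d$ of finite measure let $E^*$ be the open ball centred at $0$ with the same Lebesgue measure as $E$, and let $|\varphi|^*(x)=\int_0^\infty \mathbf 1_{\{y:|\varphi(y)|>\lambda\}^*}(x)\,d\lambda$ be the symmetric decreasing rearrangement of $\varphi$. Theorem. For every $0\le s\le 1$ there is a finite constant $C_s$, depending only on $s$, with $C_1=1$, such that for every integer $d\ge1$ and every $\varphi\in H^s(\mathbb R^d)$ one has $|\varphi|^*\in H^s(\mathbb R^d)$ and $$\bigl\||\varphi|^*\bigr\|_{H^s}\le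 C_s\|\varphi\|_{H^s},\qquad \int_{\mathbb R^d}|\xi|^{2s}\bigl|\widehat{|\varphi|^*}(\xi)\bigr|^2d\xi\le\int_{\mathbb R^d}|\xi|^{2s}|\widehat\varphi(\xi)|^2d\xi .$$ -/

import Mathlib

open MeasureTheory Set
open scoped ENNReal NNReal FourierTransform

namespace Rearrangement

/-- Euclidean space `ℝ^d` (with the Euclidean norm and Lebesgue measure). -/
abbrev Space (d : ℕ) : Type := EuclideanSpace ℝ (Fin d)

/-- The space `L²(ℝ^d)` of complex-valued functions. -/
abbrev L2 (d : ℕ) : Type := Lp (α := Space d) ℂ 2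

/-- The symmetric rearrangement `E^*` of a set `E ⊆ ℝ^d` of finite measure: the open ball
`B(0, r)` centred at the origin, where `|B(0, 1)| r ^ d = |E|`. -/
noncomputable def setRearr {d : ℕ} (E : Set (Space d)) : Set (Space d) :=
  Metric.ball 0 ((volume E / volume (Metric.ball (0 : Space d) 1)).toReal ^ (1 / (d : ℝ)))

/-- The ball `E^*` has the same volume as `E`. -/
theorem volume_setRearr {d : ℕ} (hd : 1 ≤ d) (E : Set (Space d)) (hE : volume E ≠ ∞) :
    volume (setRearr E) = volume E := by
  have : Nonempty (Fin d) := ⟨⟨0, hd⟩⟩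
  have : Nontrivial (Space d) := by infer_instance
  have h0 : volume (Metric.ball (0 : Space d) 1) ≠ 0 :=
    (Metric.measure_ball_pos volume _ one_pos).ne'
  have h1 : volume (Metric.ball (0 : Space d) 1) ≠ ∞ := measure_ball_lt_top.ne
  have hd' : (d : ℝ) ≠ 0 := by positivity
  unfold setRearr
  rw [Measure.addHaar_ball _ _ (by positivity), finrank_euclideanSpace_fin,
    ← Real.rpow_natCast, ← Real.rpow_mul ENNReal.toReal_nonneg, one_div_mul_cancel hd',
    Real.rpow_one, ENNReal.ofReal_toReal (ENNReal.div_ne_top hE h0),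
    ENNReal.div_mul_cancel h0 h1]

/-- The symmetric decreasing rearrangement `|φ|^*`, through the layer-cake representation
`|φ|^*(x) = ∫_0^∞ 1_{{y : |φ(y)| > λ}^*}(x) dλ`, with values in `[0, ∞]`
(for `φ` in `L²` the value `∞` can only occur at the origin). -/
noncomputable def symmRearr {d : ℕ} (φ : Space d → ℂ) (x : Space d) : ℝ≥0∞ :=
  ∫⁻ t in Ioi (0 : ℝ), (setRearr {y : Space d | t < ‖φ y‖}).indicator (fun _ => 1) x

/-- `|φ|^*` as a complex-valued function. -/
noncomputable def symmRearrFun {d : ℕ} (φ : Space d → ℂ) (x : Space d) : ℂ :=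
  ((symmRearr φ x).toReal : ℂ)

/-- The Sobolev norm `‖φ‖_{H^s} = (∫ |φ̂(ξ)|² (1 + |ξ|²)^s dξ)^{1/2}`, with values in `[0, ∞]`;
`𝓕` is the Fourier–Plancherel transform on `L²`, with kernel `exp (-2πi⟨t, ξ⟩)`. -/
noncomputable def sobolevNorm {d : ℕ} (s : ℝ) (φ : L2 d) : ℝ≥0∞ :=
  (∫⁻ ξ : Space d, ‖(𝓕 φ : L2 d) ξ‖ₑ ^ 2 * ENNReal.ofReal ((1 + ‖ξ‖ ^ 2) ^ s)) ^ (1 / 2 : ℝ)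

/-- The homogeneous Sobolev energy `∫ |ξ|^{2s} |φ̂(ξ)|² dξ`, with values in `[0, ∞]`. -/
noncomputable def homogeneousEnergy {d : ℕ} (s : ℝ) (φ : L2 d) : ℝ≥0∞ :=
  ∫⁻ ξ : Space d, ENNReal.ofReal (‖ξ‖ ^ (2 * s)) * ‖(𝓕 φ : L2 d) ξ‖ₑ ^ 2

/-- Membership of `φ ∈ L²(ℝ^d)` in the Sobolev space `H^s(ℝ^d)`, for `s ≥ 0`. -/
def MemSobolevSpace {d : ℕ} (s : ℝ) (φ : L2 d) : Prop :=
  sobolevNorm s φ < ∞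

end Rearrangement

/-! For `0 < s < 1` the weight `|ξ|^{2s}` is a positive superposition over `t > 0` of the functions
`1 - exp (-t|ξ|²)`; for `s = 1` it is the limit of their quotients by `t` as `t → 0`. It therefore
suffices that every heat energy `∫ (1 - exp (-t|ξ|²)) |φ̂|²` does not increase under rearrangement.
By Plancherel this energy is a constant multiple of `∬ exp (-b|x - y|²) |φ(x) - φ(y)|² dx dy` with
`b = π²/t` (`differenceEnergy_gaussKernel`). When the square is expanded, the diagonal terms see
only the L² norm, which rearrangement preserves, and the cross term is controlled by Riesz's
inequality for a decreasing kernel (`kernelForm_le_symmRearr`).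

The layer-cake formula reduces Riesz's inequality to two sets, where it is proved by polarization.
Polarizing both sets in the same hyperplane does not lower their interaction
(`kernelForm_le_polarize`). If a bounded set differs from its ball by more than `η`, averaging over
hyperplanes yields a polarization that increases the part inside the ball by an amount depending
only on `η` and the bounding radius (`exists_mirror_match`). Such gains can occur only finitely
often, so both sets get within `η` of their balls, and integrability of the kernel makes the
remaining error small.

For the full norm, `(1 + |ξ|²)^s` is compared with `1 + |ξ|^{2s}`: they coincide at `s = 1`, which
gives `C_1 = 1`, and agree up to a factor `2` otherwise. -/

namespace Rearrangement

/-! ### Translations and Plancherel -/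

/-- Translation of an `L²` function by `z`. -/
noncomputable def translate {d : ℕ} (z : Space d) (φ : L2 d) : L2 d :=
  Lp.compMeasurePreserving (fun x => x - z) (measurePreserving_sub_right volume z) φ

theorem coeFn_translate {d : ℕ} (z : Space d) (φ : L2 d) :
    translate z φ =ᵐ[volume] fun x => φ (x - z) :=
  Lp.coeFn_compMeasurePreserving _ _

theorem continuous_translate {d : ℕ} (z : Space d) : Continuous (translate z) :=
  (Lp.isometry_compMeasurePreserving (measurePreserving_sub_right volume z)).continuous

/-- The unimodular function `ξ ↦ exp (-2πi⟨z, ξ⟩)`. -/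
noncomputable def phase {d : ℕ} (z ξ : Space d) : ℂ :=
  Complex.exp (((-2 * Real.pi * inner ℝ z ξ : ℝ) : ℂ) * Complex.I)

theorem continuous_phase {d : ℕ} : Continuous fun p : Space d × Space d => phase p.1 p.2 := by
  unfold phase; fun_prop

theorem norm_phase {d : ℕ} (z ξ : Space d) : ‖phase z ξ‖ = 1 :=
  Complex.norm_exp_ofReal_mul_I _

theorem memLp_phase {d : ℕ} (z : Space d) : MemLp (phase z) ∞ :=
  memLp_top_of_bound (continuous_phase.comp (Continuous.prodMk_right z)).aestronglyMeasurable 1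
    (.of_forall fun ξ => (norm_phase z ξ).le)

theorem fourier_translate_schwartz {d : ℕ} (z : Space d) (f : SchwartzMap (Space d) ℂ)
    (ξ : Space d) :
    𝓕 (fun x => f (x - z)) ξ = phase z ξ * 𝓕 (f : Space d → ℂ) ξ := by
  have h := congrFun (VectorFourier.fourierIntegral_comp_add_right Real.fourierChar
    (volume : Measure (Space d)) (innerₗ (Space d)) (f : Space d → ℂ) (-z)) ξ
  have h2 : (Real.fourierChar ((innerₗ (Space d)) (-z) ξ) : ℂ) = phase z ξ := by
    simp [phase, Real.fourierChar_apply]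
  rw [Circle.smul_def, h2] at h
  simp only [sub_eq_add_neg]
  exact h

/-- Both sides are continuous in `φ`, multiplication by the bounded phase being a bounded operator
`M` on L², so Schwartz functions suffice. -/
theorem fourier_translate {d : ℕ} (z : Space d) (φ : L2 d) :
    (𝓕 (translate z φ) : L2 d) =ᵐ[volume] fun ξ => phase z ξ * (𝓕 φ : L2 d) ξ := by
  let M := (ContinuousLinearMap.mul ℂ ℂ).holderL (volume : Measure (Space d)) ∞ 2 2
    (memLp_phase z).toLp
  have hM : ∀ ψ : L2 d, M ψ =ᵐ[volume] fun ξ => phase z ξ * ψ ξ := fun ψ => by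
    filter_upwards [(ContinuousLinearMap.mul ℂ ℂ).coeFn_holder (r := 2) (memLp_phase z).toLp ψ,
      (memLp_phase z).coeFn_toLp] with ξ h1 h2
    exact h1.trans (by rw [h2]; rfl)
  suffices h : (𝓕 (translate z φ) : L2 d) = M (𝓕 φ) by rw [h]; exact hM _
  refine DenseRange.induction_on (p := fun φ : L2 d => (𝓕 (translate z φ) : L2 d) = M (𝓕 φ))
    (SchwartzMap.denseRange_toLpCLM (E := Space d) (F := ℂ) (p := 2) (μ := volume)
      ENNReal.ofNat_ne_top) φ (isClosed_eq ?_ ?_) fun f => ?_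
  · exact (FourierTransform.continuous_fourier).comp (continuous_translate z)
  · exact M.continuous.comp FourierTransform.continuous_fourier
  · simp only [SchwartzMap.toLpCLM_apply]
    have h1 : translate z (f.toLp 2) = (f.compSubConstCLM ℝ z).toLp 2 := by
      refine Lp.ext ?_
      filter_upwards [coeFn_translate z (f.toLp 2),
        (measurePreserving_sub_right volume z).quasiMeasurePreserving.ae (f.coeFn_toLp 2 volume),
        (f.compSubConstCLM ℝ z).coeFn_toLp 2 volume] with x h1 h2 h3
      rw [h1, h2, h3]; rfl
    rw [h1, SchwartzMap.toLp_fourier_eq, SchwartzMap.toLp_fourier_eq]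
    refine Lp.ext ?_
    filter_upwards [hM ((𝓕 f).toLp 2), (𝓕 f).coeFn_toLp 2 volume,
      (𝓕 (f.compSubConstCLM ℝ z)).coeFn_toLp 2 volume] with x h1 h2 h3
    rw [h1, h2, h3, SchwartzMap.fourier_coe, SchwartzMap.fourier_coe]
    exact fourier_translate_schwartz z f x

theorem lintegral_enorm_sq_eq {d : ℕ} (φ : L2 d) : ∫⁻ x, ‖φ x‖ₑ ^ 2 = ‖φ‖ₑ ^ 2 := by
  rw [Lp.enorm_def, eLpNorm_eq_lintegral_rpow_enorm_toReal (by norm_num) (by norm_num)]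
  simp only [ENNReal.toReal_ofNat, ENNReal.rpow_ofNat, one_div]
  rw [← ENNReal.rpow_natCast, ← ENNReal.rpow_mul]
  simp

theorem lintegral_enorm_fourier_sq {d : ℕ} (φ : L2 d) :
    ∫⁻ ξ, ‖(𝓕 φ : L2 d) ξ‖ₑ ^ 2 = ∫⁻ x, ‖φ x‖ₑ ^ 2 := by
  rw [lintegral_enorm_sq_eq, lintegral_enorm_sq_eq, ← ofReal_norm, ← ofReal_norm,
    Lp.norm_fourier_eq]

theorem lintegral_enorm_translate_sub_sq {d : ℕ} (z : Space d) (φ : L2 d) :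
    ∫⁻ x, ‖φ (x - z) - φ x‖ₑ ^ 2 =
      ∫⁻ ξ, ‖phase z ξ - 1‖ₑ ^ 2 * ‖(𝓕 φ : L2 d) ξ‖ₑ ^ 2 := by
  have h := lintegral_enorm_fourier_sq (translate z φ - φ)
  have h1 : (𝓕 (translate z φ - φ) : L2 d) = 𝓕 (translate z φ) - 𝓕 φ :=
    (Lp.fourierTransformₗᵢ (Space d) ℂ).map_sub _ _
  rw [h1] at h
  refine Eq.trans ?_ (h.symm.trans ?_)
  · refine lintegral_congr_ae ?_
    filter_upwards [coeFn_translate z φ, Lp.coeFn_sub (translate z φ) φ] with x h1 h2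
    rw [h2, Pi.sub_apply, h1]
  · refine lintegral_congr_ae ?_
    filter_upwards [fourier_translate z φ, Lp.coeFn_sub (𝓕 (translate z φ) : L2 d) (𝓕 φ)]
      with x h1 h2
    rw [h2, Pi.sub_apply, h1, ← mul_pow, ← enorm_mul, sub_mul, one_mul]

/-! ### Gaussian kernels and the heat energy -/

/-- The Gaussian kernel, with values in `[0, ∞]`. -/
noncomputable def gaussKernel (b r : ℝ) : ℝ≥0∞ := ENNReal.ofReal (Real.exp (-b * r ^ 2))

theorem measurable_gaussKernel (b : ℝ) : Measurable (gaussKernel b) := by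
  unfold gaussKernel; fun_prop

theorem gaussKernel_anti {b : ℝ} (hb : 0 ≤ b) {r r' : ℝ} (hr : 0 ≤ r) (h : r ≤ r') :
    gaussKernel b r' ≤ gaussKernel b r := by
  refine ENNReal.ofReal_le_ofReal (Real.exp_le_exp.2 ?_)
  have := pow_le_pow_left₀ hr h 2
  nlinarith

theorem integrable_gauss {d : ℕ} {b : ℝ} (hb : 0 < b) :
    Integrable fun z : Space d => Real.exp (-b * ‖z‖ ^ 2) := by
  -- The integral of a non-integrable function is `0` by convention, which contradicts the positive
  -- value of the Gaussian integral.
  by_contra h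
  have h1 := GaussianFourier.integral_rexp_neg_mul_sq_norm (V := Space d) hb
  rw [integral_undef h] at h1
  have : 0 < (Real.pi / b) ^ ((Module.finrank ℝ (Space d) : ℝ) / 2) :=
    Real.rpow_pos_of_pos (by positivity) _
  exact this.ne h1

theorem lintegral_gaussKernel {d : ℕ} {b : ℝ} (hb : 0 < b) :
    ∫⁻ z : Space d, gaussKernel b ‖z‖ = ENNReal.ofReal ((Real.pi / b) ^ ((d : ℝ) / 2)) := by
  unfold gaussKernel
  rw [← ofReal_integral_eq_lintegral_ofReal (integrable_gauss hb)
    (.of_forall fun z => (Real.exp_pos _).le), GaussianFourier.integral_rexp_neg_mul_sq_norm hb]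
  simp

/-- This is the real part of the Fourier transform of a Gaussian. -/
theorem integral_gauss_mul_cos {d : ℕ} {b : ℝ} (hb : 0 < b) (ξ : Space d) :
    ∫ z : Space d, Real.exp (-b * ‖z‖ ^ 2) * Real.cos (2 * Real.pi * inner ℝ z ξ) =
      (Real.pi / b) ^ ((d : ℝ) / 2) * Real.exp (-Real.pi ^ 2 * ‖ξ‖ ^ 2 / b) := by
  have h := fourier_gaussian_innerProductSpace (V := Space d) (b := b) (by simpa using hb) ξ
  rw [Real.fourier_eq'] at h
  have hint : Integrable fun v : Space d => Complex.exp (((-2 * Real.pi * inner ℝ v ξ : ℝ) : ℂ) *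
      Complex.I) • Complex.exp (-b * ‖v‖ ^ 2) := by
    refine Integrable.mono' (integrable_gauss hb) (by fun_prop) (.of_forall fun z => ?_)
    rw [norm_smul, Complex.norm_exp_ofReal_mul_I, one_mul, Complex.norm_exp]
    simp [← Complex.ofReal_pow]
  have h2 := congrArg Complex.re h
  rw [← RCLike.re_eq_complex_re, ← integral_re hint] at h2
  have e1 : ∀ v : Space d, RCLike.re (Complex.exp (((-2 * Real.pi * inner ℝ v ξ : ℝ) : ℂ) *
      Complex.I) • Complex.exp (-b * ‖v‖ ^ 2)) =
      Real.exp (-b * ‖v‖ ^ 2) * Real.cos (2 * Real.pi * inner ℝ v ξ) := fun v => by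
    have : Complex.exp (-b * ‖v‖ ^ 2) = ((Real.exp (-b * ‖v‖ ^ 2) : ℝ) : ℂ) := by push_cast; rfl
    rw [this, RCLike.re_eq_complex_re, smul_eq_mul, mul_comm, Complex.re_ofReal_mul,
      Complex.exp_ofReal_mul_I_re]
    congr 1
    rw [← Real.cos_neg]; congr 1; ring
  simp only [e1] at h2
  rw [h2, finrank_euclideanSpace_fin]
  have e2 : ((Real.pi : ℂ) / b) ^ ((d : ℂ) / 2) = (((Real.pi / b) ^ ((d : ℝ) / 2) : ℝ) : ℂ) := by
    rw [Complex.ofReal_cpow (by positivity)]; push_cast; rfl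
  have e3 : Complex.exp (-Real.pi ^ 2 * ‖ξ‖ ^ 2 / b) =
    ((Real.exp (-Real.pi ^ 2 * ‖ξ‖ ^ 2 / b) : ℝ) : ℂ) := by push_cast; rfl
  rw [e2, e3, ← Complex.ofReal_mul, RCLike.re_eq_complex_re, Complex.ofReal_re]

theorem enorm_phase_sub_one_sq {d : ℕ} (z ξ : Space d) :
    ‖phase z ξ - 1‖ₑ ^ 2 = ENNReal.ofReal (2 * (1 - Real.cos (2 * Real.pi * inner ℝ z ξ))) := by
  rw [← ofReal_norm, ← ENNReal.ofReal_pow (norm_nonneg _)]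
  congr 1
  have h1 : Real.cos (2 * Real.pi * inner ℝ z ξ) = Real.cos (-2 * Real.pi * inner ℝ z ξ) := by
    rw [← Real.cos_neg]; congr 1; ring
  rw [h1, phase, Complex.exp_mul_I, ← Complex.ofReal_cos, ← Complex.ofReal_sin,
    ← Complex.normSq_eq_norm_sq, Complex.normSq_apply]
  simp only [Complex.sub_re, Complex.add_re, Complex.ofReal_re, Complex.mul_re, Complex.I_re,
    Complex.I_im, Complex.ofReal_im, Complex.one_re, Complex.sub_im, Complex.add_im,
    Complex.mul_im, Complex.one_im]
  nlinarith [Real.sin_sq_add_cos_sq (-2 * Real.pi * inner ℝ z ξ)]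

theorem lintegral_gaussKernel_mul_phase {d : ℕ} {b : ℝ} (hb : 0 < b) (ξ : Space d) :
    ∫⁻ z : Space d, gaussKernel b ‖z‖ * ‖phase z ξ - 1‖ₑ ^ 2 =
      ENNReal.ofReal (2 * (Real.pi / b) ^ ((d : ℝ) / 2)) *
        ENNReal.ofReal (1 - Real.exp (-(Real.pi ^ 2 / b * ‖ξ‖ ^ 2))) := by
  simp only [enorm_phase_sub_one_sq, gaussKernel]
  simp only [← ENNReal.ofReal_mul (Real.exp_pos _).le]
  have hi : Integrable fun z : Space d =>
      Real.exp (-b * ‖z‖ ^ 2) * Real.cos (2 * Real.pi * inner ℝ z ξ) := by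
    refine Integrable.mono' (integrable_gauss hb) (by fun_prop) (.of_forall fun z => ?_)
    rw [norm_mul, Real.norm_of_nonneg (Real.exp_pos _).le]
    exact mul_le_of_le_one_right (Real.exp_pos _).le (Real.abs_cos_le_one _)
  have e : ∀ z : Space d, Real.exp (-b * ‖z‖ ^ 2) *
      (2 * (1 - Real.cos (2 * Real.pi * inner ℝ z ξ))) = 2 * (Real.exp (-b * ‖z‖ ^ 2) -
        Real.exp (-b * ‖z‖ ^ 2) * Real.cos (2 * Real.pi * inner ℝ z ξ)) := fun z => by ring
  rw [← ofReal_integral_eq_lintegral_ofReal]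
  · simp only [e]
    rw [integral_const_mul, integral_sub (integrable_gauss hb) hi, integral_gauss_mul_cos hb,
      GaussianFourier.integral_rexp_neg_mul_sq_norm hb, ← ENNReal.ofReal_mul (by positivity),
      finrank_euclideanSpace_fin]
    congr 1
    have : -Real.pi ^ 2 * ‖ξ‖ ^ 2 / b = -(Real.pi ^ 2 / b * ‖ξ‖ ^ 2) := by ring
    rw [this]; ring
  · simp only [e]
    exact ((integrable_gauss hb).sub hi).const_mul 2
  · exact .of_forall fun z => mul_nonneg (Real.exp_pos _).le
      (mul_nonneg two_pos.le (sub_nonneg.2 (Real.cos_le_one _)))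

/-- The energy of the heat semigroup at time `t`. -/
noncomputable def heatEnergy {d : ℕ} (t : ℝ) (φ : L2 d) : ℝ≥0∞ :=
  ∫⁻ ξ : Space d, ENNReal.ofReal (1 - Real.exp (-(t * ‖ξ‖ ^ 2))) * ‖(𝓕 φ : L2 d) ξ‖ₑ ^ 2

/-- The double integral `∬ g(|x - y|) |φ(x) - φ(y)|² dx dy`. -/
noncomputable def differenceEnergy {d : ℕ} (g : ℝ → ℝ≥0∞) (φ : Space d → ℂ) : ℝ≥0∞ :=
  ∫⁻ x, ∫⁻ y, g ‖x - y‖ * ‖φ x - φ y‖ₑ ^ 2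

/-- With `y = x - z`, Plancherel in `x` turns the difference into the multiplier `|phase z ξ - 1|²`;
its Gaussian average over `z` is explicit. -/
theorem differenceEnergy_gaussKernel {d : ℕ} {b : ℝ} (hb : 0 < b) (φ : L2 d) :
    differenceEnergy (gaussKernel b) φ =
      ENNReal.ofReal (2 * (Real.pi / b) ^ ((d : ℝ) / 2)) * heatEnergy (Real.pi ^ 2 / b) φ := by
  have hφ : Measurable φ := (Lp.stronglyMeasurable φ).measurable
  have hF : Measurable (𝓕 φ : L2 d) := (Lp.stronglyMeasurable _).measurable
  have hg := measurable_gaussKernel b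
  have hp : Measurable fun p : Space d × Space d => phase p.1 p.2 := continuous_phase.measurable
  calc differenceEnergy (gaussKernel b) φ
      = ∫⁻ x : Space d, ∫⁻ z : Space d, gaussKernel b ‖z‖ * ‖φ (x - z) - φ x‖ₑ ^ 2 := by
        refine lintegral_congr fun x => ?_
        rw [← lintegral_sub_left_eq_self _ x]
        refine lintegral_congr fun z => ?_
        rw [sub_sub_cancel, enorm_sub_rev]
    _ = ∫⁻ z : Space d, ∫⁻ x : Space d, gaussKernel b ‖z‖ * ‖φ (x - z) - φ x‖ₑ ^ 2 :=
        lintegral_lintegral_swap (by fun_prop)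
    _ = ∫⁻ z : Space d, ∫⁻ ξ : Space d, gaussKernel b ‖z‖ * ‖phase z ξ - 1‖ₑ ^ 2 *
          ‖(𝓕 φ : L2 d) ξ‖ₑ ^ 2 := by
        refine lintegral_congr fun z => ?_
        rw [lintegral_const_mul _ (by fun_prop), lintegral_enorm_translate_sub_sq,
          ← lintegral_const_mul]
        · simp only [mul_assoc]
        · have := hp.comp (measurable_prodMk_left (x := z))
          simp only [Function.comp_def] at this
          fun_prop
    _ = ∫⁻ ξ : Space d, ∫⁻ z : Space d, gaussKernel b ‖z‖ * ‖phase z ξ - 1‖ₑ ^ 2 *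
          ‖(𝓕 φ : L2 d) ξ‖ₑ ^ 2 := by
        refine lintegral_lintegral_swap (Measurable.aemeasurable ?_)
        simp only [Function.uncurry_def]
        fun_prop
    _ = _ := by
        rw [heatEnergy, ← lintegral_const_mul _ (by fun_prop)]
        refine lintegral_congr fun ξ => ?_
        have := hp.comp (measurable_prodMk_right (y := ξ))
        simp only [Function.comp_def] at this
        rw [lintegral_mul_const _ (by fun_prop), lintegral_gaussKernel_mul_phase hb, mul_assoc]

/-! ### Subordination: from heat energies to homogeneous energies -/

theorem lintegral_comp_smul {E : Type*} [NormedAddCommGroup E] [NormedSpace ℝ E]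
    [MeasurableSpace E] [BorelSpace E] [FiniteDimensional ℝ E] (μ : Measure E) [μ.IsAddHaarMeasure]
    {F : E → ℝ≥0∞} (hF : Measurable F) {c : ℝ} (hc : c ≠ 0) :
    ∫⁻ x, F (c • x) ∂μ = ENNReal.ofReal |(c ^ Module.finrank ℝ E)⁻¹| * ∫⁻ x, F x ∂μ := by
  rw [← smul_eq_mul, ← lintegral_smul_measure, ← Measure.map_addHaar_smul μ hc,
    lintegral_map hF (measurable_const_smul c)]

/-- Near `0` the bound `1 - exp (-u) ≤ u` leaves `u ^ (-s)`, integrable as `s < 1`; beyond `1` the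
factor is at most `1` and `u ^ (-1 - s)` is integrable as `s > 0`. -/
theorem integrableOn_rpow_mul_one_sub_exp {s : ℝ} (hs : 0 < s) (hs1 : s < 1) :
    IntegrableOn (fun u : ℝ => u ^ (-1 - s) * (1 - Real.exp (-u))) (Ioi 0) := by
  rw [← Ioc_union_Ioi_eq_Ioi zero_le_one]
  have hm : ∀ S : Set ℝ, AEStronglyMeasurable (fun u : ℝ => u ^ (-1 - s) * (1 - Real.exp (-u)))
      (volume.restrict S) := fun S => by
    have : Measurable fun u : ℝ => u ^ (-1 - s) * (1 - Real.exp (-u)) := by fun_prop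
    exact this.aestronglyMeasurable
  refine IntegrableOn.union ?_ ?_
  · have h : IntegrableOn (fun u : ℝ => u ^ (-s)) (Ioc 0 1) := by
      rw [← intervalIntegrable_iff_integrableOn_Ioc_of_le zero_le_one]
      exact intervalIntegral.intervalIntegrable_rpow' (by linarith)
    refine Integrable.mono' h (hm _) ((ae_restrict_iff' measurableSet_Ioc).2 (.of_forall ?_))
    intro u hu
    have h1 : Real.exp (-u) ≤ 1 := Real.exp_le_one_iff.2 (by linarith [hu.1])
    rw [Real.norm_of_nonneg (mul_nonneg (Real.rpow_nonneg hu.1.le _) (by linarith))]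
    calc u ^ (-1 - s) * (1 - Real.exp (-u)) ≤ u ^ (-1 - s) * u :=
          mul_le_mul_of_nonneg_left (by linarith [Real.add_one_le_exp (-u)])
            (Real.rpow_nonneg hu.1.le _)
      _ = u ^ (-s) := by rw [← Real.rpow_add_one hu.1.ne']; congr 1; ring
  · refine Integrable.mono' (integrableOn_Ioi_rpow_of_lt (a := -1 - s) (by linarith) one_pos)
      (hm _) ((ae_restrict_iff' measurableSet_Ioi).2 (.of_forall ?_))
    intro u hu
    have hu0 : (0 : ℝ) < u := one_pos.trans hu
    have h1 : Real.exp (-u) ≤ 1 := Real.exp_le_one_iff.2 (by linarith)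
    rw [Real.norm_of_nonneg (mul_nonneg (Real.rpow_nonneg hu0.le _) (by linarith))]
    exact mul_le_of_le_one_right (Real.rpow_nonneg hu0.le _) (by linarith [Real.exp_pos (-u)])

/-- The weight `u ^ (-1 - s) (1 - exp (-u))` whose integral normalizes the subordination formula. -/
noncomputable def subordWeight (s u : ℝ) : ℝ≥0∞ :=
  ENNReal.ofReal (u ^ (-1 - s)) * ENNReal.ofReal (1 - Real.exp (-u))

theorem measurable_subordWeight (s : ℝ) : Measurable (subordWeight s) := by
  unfold subordWeight; fun_prop

theorem lintegral_subordWeight_ne_top {s : ℝ} (hs : 0 < s) (hs1 : s < 1) :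
    ∫⁻ u in Ioi (0 : ℝ), subordWeight s u ≠ ∞ := by
  refine ne_of_eq_of_ne (setLIntegral_congr_fun measurableSet_Ioi fun u hu => ?_)
    (integrableOn_rpow_mul_one_sub_exp hs hs1).lintegral_lt_top.ne
  rw [subordWeight, ENNReal.ofReal_mul (Real.rpow_nonneg (le_of_lt hu) _)]

theorem lintegral_subordWeight_ne_zero (s : ℝ) :
    ∫⁻ u in Ioi (0 : ℝ), subordWeight s u ≠ 0 := by
  rw [← pos_iff_ne_zero, setLIntegral_pos_iff (measurable_subordWeight s)]
  have : Function.support (subordWeight s) ∩ Ioi 0 = Ioi 0 := by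
    refine inter_eq_right.2 fun u (hu : 0 < u) => ?_
    refine mul_ne_zero ?_ ?_
    · simpa using Real.rpow_pos_of_pos hu _
    · simpa using hu
  rw [this]; simp

/-- Substitute `u = t a`. -/
theorem lintegral_subordination {s : ℝ} (hs : 0 < s) {a : ℝ} (ha : 0 ≤ a) :
    ∫⁻ t in Ioi (0 : ℝ), ENNReal.ofReal (t ^ (-1 - s)) *
        ENNReal.ofReal (1 - Real.exp (-(t * a))) =
      ENNReal.ofReal (a ^ s) * ∫⁻ u in Ioi (0 : ℝ), subordWeight s u := by
  rcases ha.eq_or_lt with rfl | ha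
  · simp [Real.zero_rpow hs.ne']
  have h := lintegral_comp_smul (volume : Measure ℝ)
    ((measurable_subordWeight s).indicator measurableSet_Ioi (s := Ioi (0 : ℝ))) ha.ne'
  rw [lintegral_indicator measurableSet_Ioi] at h
  have e : (fun x : ℝ => (Ioi (0 : ℝ)).indicator (subordWeight s) (a • x)) =
      (Ioi (0 : ℝ)).indicator fun x => ENNReal.ofReal (a ^ (-1 - s)) *
        (ENNReal.ofReal (x ^ (-1 - s)) * ENNReal.ofReal (1 - Real.exp (-(x * a)))) := by
    funext x
    by_cases hx : x ∈ Ioi (0 : ℝ)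
    · rw [indicator_of_mem (show a • x ∈ Ioi 0 from mul_pos ha hx), indicator_of_mem hx,
        subordWeight, smul_eq_mul, Real.mul_rpow ha.le (le_of_lt hx),
        ENNReal.ofReal_mul (Real.rpow_nonneg ha.le _), mul_assoc, mul_comm a x]
    · rw [indicator_of_notMem hx, indicator_of_notMem]
      exact fun h => hx (pos_of_mul_pos_right h ha.le)
  rw [e, lintegral_indicator measurableSet_Ioi, lintegral_const_mul _ (by fun_prop)] at h
  -- The factor `a ^ (1 + s)` cancels `a ^ (-1 - s)` on the left and, with the Jacobian `a⁻¹`,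
  -- leaves `a ^ s` on the right.
  have h2 := congrArg (fun y => ENNReal.ofReal (a ^ (1 + s)) * y) h
  simp only [← mul_assoc, Module.finrank_self, pow_one] at h2
  rw [← ENNReal.ofReal_mul (Real.rpow_nonneg ha.le _),
    ← ENNReal.ofReal_mul (Real.rpow_nonneg ha.le _), ← Real.rpow_add ha, abs_of_pos (inv_pos.2 ha),
    ← Real.rpow_neg_one a, ← Real.rpow_add ha, show 1 + s + (-1 - s) = 0 by ring,
    show 1 + s + -1 = s by ring, Real.rpow_zero, ENNReal.ofReal_one, one_mul] at h2
  exact h2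

theorem homogeneousEnergy_mul_subordination {d : ℕ} {s : ℝ} (hs : 0 < s) (φ : L2 d) :
    homogeneousEnergy s φ * ∫⁻ u in Ioi (0 : ℝ), subordWeight s u =
      ∫⁻ t in Ioi (0 : ℝ), ENNReal.ofReal (t ^ (-1 - s)) * heatEnergy t φ := by
  have hF : Measurable (𝓕 φ : L2 d) := (Lp.stronglyMeasurable _).measurable
  have hr : ∀ ξ : Space d, ‖ξ‖ ^ (2 * s) = (‖ξ‖ ^ 2) ^ s := fun ξ => by
    rw [Real.rpow_mul (norm_nonneg _), Real.rpow_two]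
  unfold homogeneousEnergy heatEnergy
  rw [← lintegral_mul_const _ (by fun_prop)]
  calc _ = ∫⁻ ξ : Space d, ∫⁻ t in Ioi (0 : ℝ), ENNReal.ofReal (t ^ (-1 - s)) *
        ENNReal.ofReal (1 - Real.exp (-(t * ‖ξ‖ ^ 2))) * ‖(𝓕 φ : L2 d) ξ‖ₑ ^ 2 := by
        refine lintegral_congr fun ξ => ?_
        rw [lintegral_mul_const _ (by fun_prop), lintegral_subordination hs (by positivity), hr]
        ring
    _ = ∫⁻ t in Ioi (0 : ℝ), ∫⁻ ξ : Space d, ENNReal.ofReal (t ^ (-1 - s)) *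
        ENNReal.ofReal (1 - Real.exp (-(t * ‖ξ‖ ^ 2))) * ‖(𝓕 φ : L2 d) ξ‖ₑ ^ 2 :=
        lintegral_lintegral_swap (by fun_prop)
    _ = _ := by
        refine lintegral_congr fun t => ?_
        rw [← lintegral_const_mul _ (by fun_prop)]
        simp only [mul_assoc]

theorem homogeneousEnergy_le_of_heatEnergy_le {d : ℕ} {s : ℝ} (hs : 0 < s) (hs1 : s < 1)
    {f g : L2 d} (h : ∀ t > 0, heatEnergy t f ≤ heatEnergy t g) :
    homogeneousEnergy s f ≤ homogeneousEnergy s g := by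
  rw [← ENNReal.mul_le_mul_iff_left (lintegral_subordWeight_ne_zero s)
    (lintegral_subordWeight_ne_top hs hs1), homogeneousEnergy_mul_subordination hs,
    homogeneousEnergy_mul_subordination hs]
  exact setLIntegral_mono' measurableSet_Ioi fun t ht => mul_le_mul_right (h t ht) _

theorem heatEnergy_le_homogeneousEnergy_one {d : ℕ} {t : ℝ} (ht : 0 < t) (φ : L2 d) :
    ENNReal.ofReal t⁻¹ * heatEnergy t φ ≤ homogeneousEnergy 1 φ := by
  have hF : Measurable (𝓕 φ : L2 d) := (Lp.stronglyMeasurable _).measurable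
  unfold heatEnergy homogeneousEnergy
  rw [← lintegral_const_mul _ (by fun_prop)]
  refine lintegral_mono fun ξ => ?_
  dsimp only
  rw [← mul_assoc, ← ENNReal.ofReal_mul (inv_nonneg.2 ht.le)]
  gcongr
  rw [mul_one, Real.rpow_two, inv_mul_le_iff₀ ht]
  linarith [Real.add_one_le_exp (-(t * ‖ξ‖ ^ 2))]

/-- The subordination integral diverges at `s = 1`. Instead `(1 - exp (-t|ξ|²)) / t` tends to `|ξ|²`
as `t → 0` and stays below it: Fatou's lemma handles `f`, the upper bound handles `g`. -/
theorem homogeneousEnergy_one_le_of_heatEnergy_le {d : ℕ} {f g : L2 d}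
    (h : ∀ t > 0, heatEnergy t f ≤ heatEnergy t g) :
    homogeneousEnergy 1 f ≤ homogeneousEnergy 1 g := by
  have hF : Measurable (𝓕 f : L2 d) := (Lp.stronglyMeasurable _).measurable
  let t : ℕ → ℝ := fun n => 1 / ((n : ℝ) + 1)
  have ht : ∀ n, 0 < t n := fun n => Nat.one_div_pos_of_nat
  have hlim : ∀ a : ℝ, Filter.Tendsto (fun n => (t n)⁻¹ * (1 - Real.exp (-(t n * a))))
      Filter.atTop (nhds a) := fun a => by
    have h1 : HasDerivAt (fun x : ℝ => 1 - Real.exp (-(x * a))) a 0 := by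
      have := (((hasDerivAt_id (0 : ℝ)).mul_const a).neg.exp).const_sub 1
      simpa using this
    have h2 := h1.tendsto_slope_zero_right
    have h3 : Filter.Tendsto t Filter.atTop (nhdsWithin 0 (Ioi 0)) :=
      tendsto_nhdsWithin_iff.2 ⟨tendsto_one_div_add_atTop_nhds_zero_nat, .of_forall ht⟩
    simpa [Function.comp_def] using h2.comp h3
  calc homogeneousEnergy 1 f
      = ∫⁻ ξ : Space d, Filter.liminf (fun n => ENNReal.ofReal ((t n)⁻¹ *
          (1 - Real.exp (-(t n * ‖ξ‖ ^ 2)))) * ‖(𝓕 f : L2 d) ξ‖ₑ ^ 2) Filter.atTop := by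
        refine lintegral_congr fun ξ => ?_
        refine (Filter.Tendsto.liminf_eq ?_).symm
        rw [mul_one, Real.rpow_two]
        exact ENNReal.Tendsto.mul_const (ENNReal.tendsto_ofReal (hlim _))
          (.inr (ENNReal.pow_ne_top enorm_ne_top))
    _ ≤ Filter.liminf (fun n => ∫⁻ ξ : Space d, ENNReal.ofReal ((t n)⁻¹ *
          (1 - Real.exp (-(t n * ‖ξ‖ ^ 2)))) * ‖(𝓕 f : L2 d) ξ‖ₑ ^ 2) Filter.atTop :=
        lintegral_liminf_le fun n => by fun_prop
    _ ≤ homogeneousEnergy 1 g := by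
        refine Filter.liminf_le_of_le (by isBoundedDefault) fun b hb => ?_
        obtain ⟨n, hn⟩ := hb.exists
        refine hn.trans (le_trans ?_ (heatEnergy_le_homogeneousEnergy_one (ht n) g))
        refine le_trans (le_of_eq ?_) (mul_le_mul_right (h (t n) (ht n)) _)
        rw [heatEnergy, ← lintegral_const_mul _ (by fun_prop)]
        refine lintegral_congr fun ξ => ?_
        rw [ENNReal.ofReal_mul (inv_nonneg.2 (ht n).le), mul_assoc]

/-! ### Sobolev norm versus homogeneous energy -/

theorem homogeneousEnergy_zero {d : ℕ} (φ : L2 d) : homogeneousEnergy 0 φ = ∫⁻ x, ‖φ x‖ₑ ^ 2 := by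
  rw [← lintegral_enorm_fourier_sq]
  simp [homogeneousEnergy]

theorem sobolevNorm_sq {d : ℕ} (s : ℝ) (φ : L2 d) : sobolevNorm s φ ^ 2 =
    ∫⁻ ξ : Space d, ‖(𝓕 φ : L2 d) ξ‖ₑ ^ 2 * ENNReal.ofReal ((1 + ‖ξ‖ ^ 2) ^ s) := by
  rw [sobolevNorm, ← ENNReal.rpow_natCast, ← ENNReal.rpow_mul]
  simp

/-- Subadditivity of `x ↦ x ^ s` gives `(1 + |ξ|²)^s ≤ 1 + |ξ|^{2s}`. -/
theorem sobolevNorm_sq_le {d : ℕ} {s : ℝ} (hs : 0 ≤ s) (hs1 : s ≤ 1) (φ : L2 d) :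
    sobolevNorm s φ ^ 2 ≤ (∫⁻ x, ‖φ x‖ₑ ^ 2) + homogeneousEnergy s φ := by
  have hF : Measurable (𝓕 φ : L2 d) := (Lp.stronglyMeasurable _).measurable
  rw [sobolevNorm_sq, ← lintegral_enorm_fourier_sq, homogeneousEnergy,
    ← lintegral_add_left (by fun_prop)]
  refine lintegral_mono fun ξ => ?_
  dsimp only
  rw [mul_comm, ← one_add_mul]
  gcongr
  rw [← ENNReal.ofReal_one, ← ENNReal.ofReal_add zero_le_one (by positivity),
    Real.rpow_mul (norm_nonneg _), Real.rpow_two]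
  refine ENNReal.ofReal_le_ofReal ?_
  simpa using Real.rpow_add_le_add_rpow zero_le_one (sq_nonneg ‖ξ‖) hs hs1

/-- Each of `1` and `|ξ|^{2s}` is at most `(1 + |ξ|²)^s`. -/
theorem add_homogeneousEnergy_le {d : ℕ} {s : ℝ} (hs : 0 ≤ s) (φ : L2 d) :
    (∫⁻ x, ‖φ x‖ₑ ^ 2) + homogeneousEnergy s φ ≤ 2 * sobolevNorm s φ ^ 2 := by
  rw [sobolevNorm_sq, ← lintegral_enorm_fourier_sq, homogeneousEnergy,
    two_mul (lintegral _ _)]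
  refine add_le_add (lintegral_mono fun ξ => ?_) (lintegral_mono fun ξ => ?_)
  · refine le_mul_of_one_le_right' ?_
    rw [ENNReal.one_le_ofReal]
    exact Real.one_le_rpow (by nlinarith [sq_nonneg ‖ξ‖]) hs
  · dsimp only
    rw [mul_comm, Real.rpow_mul (norm_nonneg _), Real.rpow_two]
    gcongr
    linarith

theorem sobolevNorm_one_sq {d : ℕ} (φ : L2 d) :
    sobolevNorm 1 φ ^ 2 = (∫⁻ x, ‖φ x‖ₑ ^ 2) + homogeneousEnergy 1 φ := by
  have hF : Measurable (𝓕 φ : L2 d) := (Lp.stronglyMeasurable _).measurable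
  rw [sobolevNorm_sq, ← lintegral_enorm_fourier_sq, homogeneousEnergy,
    ← lintegral_add_left (by fun_prop)]
  refine lintegral_congr fun ξ => ?_
  rw [mul_comm, ← one_add_mul, mul_one, Real.rpow_one, Real.rpow_two,
    ENNReal.ofReal_add zero_le_one (by positivity), ENNReal.ofReal_one]

/-! ### Reflections and polarization -/

section Mirror

variable {E : Type*} [NormedAddCommGroup E] [InnerProductSpace ℝ E]

/-- The coordinate in direction `v` with respect to the hyperplane `2⟨x, v⟩ = t |v|²`,
scaled so that the reflection in the hyperplane is `x ↦ x - mirrorCoord v t x • v`. -/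
noncomputable def mirrorCoord (v : E) (t : ℝ) (x : E) : ℝ := 2 * inner ℝ x v / ‖v‖ ^ 2 - t

/-- The reflection in the hyperplane `2⟨x, v⟩ = t |v|²`. -/
noncomputable def mirror (v : E) (t : ℝ) (x : E) : E := x - mirrorCoord v t x • v

theorem two_mul_inner_eq {v : E} (hv : v ≠ 0) (t : ℝ) (x : E) :
    2 * inner ℝ x v = (mirrorCoord v t x + t) * ‖v‖ ^ 2 := by
  have : ‖v‖ ≠ 0 := norm_ne_zero_iff.2 hv
  unfold mirrorCoord
  field_simp
  ring

theorem mirrorCoord_mirror {v : E} (hv : v ≠ 0) (t : ℝ) (x : E) :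
    mirrorCoord v t (mirror v t x) = -mirrorCoord v t x := by
  have hv' : ‖v‖ ≠ 0 := norm_ne_zero_iff.2 hv
  have h := two_mul_inner_eq hv t x
  rw [mirrorCoord, mirror, inner_sub_left, real_inner_smul_left, real_inner_self_eq_norm_sq,
    mul_sub, h]
  field_simp
  ring

theorem mirror_mirror {v : E} (hv : v ≠ 0) (t : ℝ) (x : E) : mirror v t (mirror v t x) = x := by
  rw [mirror, mirrorCoord_mirror hv, mirror, neg_smul, sub_neg_eq_add, sub_add_cancel]

theorem norm_mirror_sub_mirror {v : E} (hv : v ≠ 0) (t : ℝ) (x y : E) :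
    ‖mirror v t x - mirror v t y‖ = ‖x - y‖ := by
  have h : mirror v t x - mirror v t y =
      (x - y) - (mirrorCoord v t x - mirrorCoord v t y) • v := by
    unfold mirror; rw [sub_smul]; abel
  have hx := two_mul_inner_eq hv t x
  have hy := two_mul_inner_eq hv t y
  rw [h, ← sq_eq_sq₀ (norm_nonneg _) (norm_nonneg _), norm_sub_sq_real, real_inner_smul_right,
    norm_smul, mul_pow, Real.norm_eq_abs, sq_abs, inner_sub_left]
  linear_combination (mirrorCoord v t x - mirrorCoord v t y) * (hy - hx)

/-- The squared distances differ by exactly `mirrorCoord v t x * mirrorCoord v t y * ‖v‖ ^ 2`. -/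
theorem norm_sub_le_norm_sub_mirror {v : E} (hv : v ≠ 0) (t : ℝ) {x y : E}
    (hx : 0 < mirrorCoord v t x) (hy : 0 < mirrorCoord v t y) :
    ‖x - y‖ ≤ ‖x - mirror v t y‖ := by
  have h : x - mirror v t y = (x - y) + mirrorCoord v t y • v := by
    unfold mirror; abel
  have h1 := two_mul_inner_eq hv t x
  have h2 := two_mul_inner_eq hv t y
  rw [h, ← sq_le_sq₀ (norm_nonneg _) (norm_nonneg _), norm_add_sq_real, real_inner_smul_right,
    norm_smul, mul_pow, Real.norm_eq_abs, sq_abs, inner_sub_left]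
  have h3 : 0 ≤ mirrorCoord v t x * mirrorCoord v t y * ‖v‖ ^ 2 := by positivity
  linear_combination h3 + mirrorCoord v t y * (h2 - h1)

theorem norm_mirror_sq {v : E} (hv : v ≠ 0) (t : ℝ) (x : E) :
    ‖mirror v t x‖ ^ 2 = ‖x‖ ^ 2 - mirrorCoord v t x * t * ‖v‖ ^ 2 := by
  have h := two_mul_inner_eq hv t x
  rw [mirror, norm_sub_sq_real, real_inner_smul_right, norm_smul, mul_pow, Real.norm_eq_abs, sq_abs]
  linear_combination -mirrorCoord v t x * h

/-- For `t ≥ 0` the origin lies in the half-space `mirrorCoord ≤ 0`, so reflecting into that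
half-space brings points closer to it. -/
theorem norm_mirror_le {v : E} (hv : v ≠ 0) {t : ℝ} (ht : 0 ≤ t) {x : E}
    (hx : 0 ≤ mirrorCoord v t x) : ‖mirror v t x‖ ≤ ‖x‖ := by
  rw [← sq_le_sq₀ (norm_nonneg _) (norm_nonneg _), norm_mirror_sq hv]
  have : 0 ≤ mirrorCoord v t x * t * ‖v‖ ^ 2 := by positivity
  linarith

/-- The polarization of `A` towards the half-space `2⟨x, v⟩ ≤ t |v|²`. -/
def polarize (v : E) (t : ℝ) (A : Set E) : Set E :=
  (A ∩ mirror v t ⁻¹' A) ∪ ((A ∪ mirror v t ⁻¹' A) ∩ {x | mirrorCoord v t x ≤ 0})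

theorem mem_polarize {v : E} {t : ℝ} {x : E} (hx : 0 < mirrorCoord v t x) (A : Set E) :
    x ∈ polarize v t A ↔ x ∈ A ∧ mirror v t x ∈ A := by
  simp only [polarize, mem_union, mem_inter_iff, mem_preimage, mem_ofPred_eq]
  constructor
  · rintro (h | ⟨_, h⟩)
    · exact h
    · exact absurd h hx.not_ge
  · exact fun h => .inl h

theorem mirror_mem_polarize {v : E} (hv : v ≠ 0) {t : ℝ} {x : E} (hx : 0 < mirrorCoord v t x)
    (A : Set E) : mirror v t x ∈ polarize v t A ↔ x ∈ A ∨ mirror v t x ∈ A := by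
  have h : mirrorCoord v t (mirror v t x) ≤ 0 := by rw [mirrorCoord_mirror hv]; linarith
  simp only [polarize, mem_union, mem_inter_iff, mem_preimage, mem_ofPred_eq, mirror_mirror hv, h]
  tauto

theorem polarize_subset_ball {v : E} (hv : v ≠ 0) {t : ℝ} (ht : 0 ≤ t) {A : Set E} {L : ℝ}
    (hA : A ⊆ Metric.ball 0 L) : polarize v t A ⊆ Metric.ball 0 L := by
  rintro x (⟨h, _⟩ | ⟨h | h, hx⟩)
  · exact hA h
  · exact hA h
  · have h1 := hA h
    rw [mem_ball_zero_iff] at h1 ⊢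
    refine lt_of_le_of_lt ?_ h1
    have h2 := norm_mirror_le hv ht (x := mirror v t x)
      (by rw [mirrorCoord_mirror hv]; exact neg_nonneg.2 hx)
    rwa [mirror_mirror hv] at h2

variable [MeasurableSpace E] [BorelSpace E] [FiniteDimensional ℝ E]

theorem measurable_mirrorCoord (v : E) (t : ℝ) : Measurable (mirrorCoord v t) := by
  unfold mirrorCoord; fun_prop

theorem measurePreserving_mirror (v : E) (t : ℝ) :
    MeasurePreserving (mirror v t) := by
  have h : mirror v t = (fun x => x + t • v) ∘ (Submodule.span ℝ {v})ᗮ.reflection := by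
    funext x
    rw [Function.comp_apply, Submodule.reflection_orthogonal_apply,
      Submodule.reflection_singleton_apply, mirror, mirrorCoord, sub_smul, real_inner_comm]
    simp only [RCLike.ofReal_real_eq_id, id_eq, two_smul]
    rw [mul_div_assoc, two_mul, add_smul]
    abel
  rw [h]
  exact (measurePreserving_add_right volume (t • v)).comp
    (LinearIsometryEquiv.measurePreserving (Submodule.span ℝ {v})ᗮ.reflection)

theorem measurableSet_polarize (v : E) (t : ℝ) {A : Set E} (hA : MeasurableSet A) :
    MeasurableSet (polarize v t A) := by
  have h1 := (measurePreserving_mirror v t).measurable hA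
  exact (hA.inter h1).union ((hA.union h1).inter
    (measurableSet_le (measurable_mirrorCoord v t) measurable_const))

theorem volume_mirrorCoord_eq_zero {v : E} (hv : v ≠ 0) (t : ℝ) :
    volume {x : E | mirrorCoord v t x = 0} = 0 := by
  have hv' : ‖v‖ ≠ 0 := norm_ne_zero_iff.2 hv
  have h : {x : E | mirrorCoord v t x = 0} ⊆
      (fun x => x - (t / 2) • v) ⁻¹' ((Submodule.span ℝ {v})ᗮ : Submodule ℝ E) := by
    intro x hx
    rw [mem_ofPred_eq] at hx
    have h1 := two_mul_inner_eq hv t x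
    rw [mem_preimage, SetLike.mem_coe, Submodule.mem_orthogonal_singleton_iff_inner_left,
      inner_sub_left, real_inner_smul_left, real_inner_self_eq_norm_sq]
    rw [hx] at h1
    linarith
  refine measure_mono_null h ?_
  rw [(measurePreserving_sub_right volume ((t / 2) • v)).measure_preimage
    (Submodule.closed_of_finiteDimensional _).measurableSet.nullMeasurableSet]
  refine Measure.addHaar_submodule _ _ fun htop => hv ?_
  rw [Submodule.orthogonal_eq_top_iff] at htop
  exact Submodule.span_singleton_eq_bot.1 htop

/-- Folding along the hyperplane, which is a null set, reduces statements about polarization to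
finite checks on pairs `{x, mirror v t x}`. -/
theorem lintegral_eq_lintegral_add_mirror {v : E} (hv : v ≠ 0) (t : ℝ) {F : E → ℝ≥0∞}
    (hF : Measurable F) :
    ∫⁻ x, F x = ∫⁻ x in {x | 0 < mirrorCoord v t x}, (F x + F (mirror v t x)) := by
  have hU : MeasurableSet {x : E | 0 < mirrorCoord v t x} :=
    measurableSet_lt measurable_const (measurable_mirrorCoord v t)
  rw [lintegral_add_left hF, ← lintegral_add_compl F hU]
  congr 1
  have h := (measurePreserving_mirror v t).setLIntegral_comp_preimage
    (f := fun x => F x) (s := {x : E | mirrorCoord v t x < 0})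
    (measurableSet_lt (measurable_mirrorCoord v t) measurable_const) hF
  have e : mirror v t ⁻¹' {x : E | mirrorCoord v t x < 0} = {x : E | 0 < mirrorCoord v t x} := by
    ext x; simp [mirrorCoord_mirror hv]
  rw [e] at h
  rw [h]
  refine setLIntegral_congr ?_
  filter_upwards [compl_mem_ae_iff.2 (volume_mirrorCoord_eq_zero hv t)] with x hx
  have hx' : mirrorCoord v t x ≠ 0 := hx
  refine propext ?_
  change ¬ 0 < mirrorCoord v t x ↔ mirrorCoord v t x < 0
  rw [not_lt]
  exact ⟨fun h => lt_of_le_of_ne h hx', le_of_lt⟩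

theorem volume_polarize {v : E} (hv : v ≠ 0) (t : ℝ) {A : Set E} (hA : MeasurableSet A) :
    volume (polarize v t A) = volume A := by
  have hm := measurableSet_polarize v t hA
  rw [← lintegral_indicator_one hm, ← lintegral_indicator_one hA,
    lintegral_eq_lintegral_add_mirror hv t (measurable_one.indicator hm),
    lintegral_eq_lintegral_add_mirror hv t (measurable_one.indicator hA)]
  refine setLIntegral_congr_fun (measurableSet_lt measurable_const (measurable_mirrorCoord v t))
    fun x hx => ?_
  classical
  simp only [indicator_apply, Pi.one_apply, mem_polarize hx, mirror_mem_polarize hv hx]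
  by_cases h1 : x ∈ A <;> by_cases h2 : mirror v t x ∈ A <;> simp [h1, h2]

/-- Within each reflected pair, mass moves towards the origin, so the part in the ball never
shrinks. It gains a point when a point of `A` outside the ball has a mirror image in the ball and
outside `A`; this gain drives the iteration below. -/
theorem volume_inter_ball_add_le {v : E} (hv : v ≠ 0) {t : ℝ} (ht : 0 ≤ t) {A : Set E}
    (hA : MeasurableSet A) (r : ℝ) :
    volume (A ∩ Metric.ball 0 r) + volume {x ∈ A \ Metric.ball 0 r |
        0 < mirrorCoord v t x ∧ mirror v t x ∈ Metric.ball 0 r \ A} ≤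
      volume (polarize v t A ∩ Metric.ball 0 r) := by
  have hσ := (measurePreserving_mirror v t).measurable
  have hm := measurableSet_polarize v t hA
  have hB : MeasurableSet (Metric.ball (0 : E) r) := Metric.isOpen_ball.measurableSet
  have hU : MeasurableSet {x : E | 0 < mirrorCoord v t x} :=
    measurableSet_lt measurable_const (measurable_mirrorCoord v t)
  set S := {x ∈ A \ Metric.ball 0 r |
        0 < mirrorCoord v t x ∧ mirror v t x ∈ Metric.ball 0 r \ A} with hS
  have hSm : MeasurableSet S := (hA.diff hB).inter (hU.inter (hσ (hB.diff hA)))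
  have hSv : volume S = ∫⁻ x in {x | 0 < mirrorCoord v t x}, S.indicator 1 x := by
    rw [← lintegral_indicator hU, ← lintegral_indicator_one hSm, indicator_indicator,
      inter_eq_right.2 fun x hx => hx.2.1]
  rw [hSv, ← lintegral_indicator_one (hA.inter hB), ← lintegral_indicator_one (hm.inter hB),
    lintegral_eq_lintegral_add_mirror hv t (measurable_one.indicator (hA.inter hB)),
    lintegral_eq_lintegral_add_mirror hv t (measurable_one.indicator (hm.inter hB)),
    ← lintegral_add_right _ (measurable_one.indicator hSm)]
  refine setLIntegral_mono' hU fun x hx => ?_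
  have hx' : 0 < mirrorCoord v t x := hx
  have hr : x ∈ Metric.ball 0 r → mirror v t x ∈ Metric.ball 0 r := fun h => by
    rw [mem_ball_zero_iff] at h ⊢
    exact (norm_mirror_le hv ht hx'.le).trans_lt h
  classical
  simp only [indicator_apply, hS, mem_inter_iff, mem_polarize hx', mirror_mem_polarize hv hx',
    mem_ofPred_eq, mem_sdiff, hx', true_and, Pi.one_apply]
  by_cases h1 : x ∈ A <;> by_cases h2 : mirror v t x ∈ A <;> by_cases h3 : x ∈ Metric.ball 0 r <;>
    by_cases h4 : mirror v t x ∈ Metric.ball 0 r <;>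
    first
    | exact absurd (hr h3) h4
    | (simp only [h1, h2, h3, h4]; simp)

/-! ### Polarization and the interaction integral -/

/-- The double integral `∬ f(x) h(y) g(|x - y|) dx dy`. -/
noncomputable def kernelForm (g : ℝ → ℝ≥0∞) (f h : E → ℝ≥0∞) : ℝ≥0∞ :=
  ∫⁻ x, ∫⁻ y, f x * h y * g ‖x - y‖

/-- The weight `p` belongs to points on the same side, `q` to points on opposite sides. The only
strict change occurs when each set has one point of its pair, on opposite sides: polarization then
replaces `q` by `p`. -/
theorem two_point_le {a a' b b' : Prop} [Decidable a] [Decidable a'] [Decidable b] [Decidable b']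
    {p q : ℝ≥0∞} (h : q ≤ p) :
    (((if a then 1 else 0) * (if b then 1 else 0) * p +
      (if a then 1 else 0) * (if b' then 1 else 0) * q) +
      ((if a' then 1 else 0) * (if b then 1 else 0) * q +
      (if a' then 1 else 0) * (if b' then 1 else 0) * p)) ≤
    (((if a ∧ a' then 1 else 0) * (if b ∧ b' then 1 else 0) * p +
      (if a ∧ a' then 1 else 0) * (if b ∨ b' then 1 else 0) * q) +
      ((if a ∨ a' then 1 else 0) * (if b ∧ b' then 1 else 0) * q +
      (if a ∨ a' then 1 else 0) * (if b ∨ b' then 1 else 0) * p)) := by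
  by_cases h1 : a <;> by_cases h2 : a' <;> by_cases h3 : b <;> by_cases h4 : b' <;>
    simp [h1, h2, h3, h4, h, add_comm]

theorem kernelForm_eq_mirror {v : E} (hv : v ≠ 0) (t : ℝ) {g : ℝ → ℝ≥0∞} (hg : Measurable g)
    {f h : E → ℝ≥0∞} (hf : Measurable f) (hh : Measurable h) :
    kernelForm g f h = ∫⁻ x in {x | 0 < mirrorCoord v t x}, ∫⁻ y in {x | 0 < mirrorCoord v t x},
      ((f x * h y * g ‖x - y‖ + f x * h (mirror v t y) * g ‖x - mirror v t y‖) +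
        (f (mirror v t x) * h y * g ‖x - mirror v t y‖ +
          f (mirror v t x) * h (mirror v t y) * g ‖x - y‖)) := by
  have hσ := (measurePreserving_mirror v t).measurable
  rw [kernelForm, lintegral_eq_lintegral_add_mirror hv t (Measurable.lintegral_prod_right
    (f := fun x y => f x * h y * g ‖x - y‖) (by fun_prop))]
  refine lintegral_congr fun x => ?_
  rw [lintegral_eq_lintegral_add_mirror hv t (by fun_prop),
    lintegral_eq_lintegral_add_mirror hv t (by fun_prop), ← lintegral_add_left (by fun_prop)]
  refine lintegral_congr fun y => ?_
  have h1 : ‖mirror v t x - y‖ = ‖x - mirror v t y‖ := by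
    rw [← norm_mirror_sub_mirror hv t, mirror_mirror hv]
  rw [norm_mirror_sub_mirror hv, h1]

theorem kernelForm_le_polarize {v : E} (hv : v ≠ 0) (t : ℝ) {g : ℝ → ℝ≥0∞} (hg : Measurable g)
    (hanti : ∀ ⦃r r' : ℝ⦄, 0 ≤ r → r ≤ r' → g r' ≤ g r) {A B : Set E} (hA : MeasurableSet A)
    (hB : MeasurableSet B) :
    kernelForm g (A.indicator 1) (B.indicator 1) ≤
      kernelForm g ((polarize v t A).indicator 1) ((polarize v t B).indicator 1) := by
  have hU : MeasurableSet {x : E | 0 < mirrorCoord v t x} :=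
    measurableSet_lt measurable_const (measurable_mirrorCoord v t)
  rw [kernelForm_eq_mirror hv t hg (measurable_one.indicator hA) (measurable_one.indicator hB),
    kernelForm_eq_mirror hv t hg (measurable_one.indicator (measurableSet_polarize v t hA))
      (measurable_one.indicator (measurableSet_polarize v t hB))]
  refine setLIntegral_mono' hU fun x hx => setLIntegral_mono' hU fun y hy => ?_
  classical
  simp only [indicator_apply, Pi.one_apply, mem_polarize hx, mirror_mem_polarize hv hx,
    mem_polarize hy, mirror_mem_polarize hv hy]
  exact two_point_le (hanti (norm_nonneg _) (norm_sub_le_norm_sub_mirror hv t hx hy))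

end Mirror

/-! ### Averaging over hyperplanes -/

section Averaging

variable {E : Type*} [NormedAddCommGroup E] [InnerProductSpace ℝ E] [MeasurableSpace E]
  [BorelSpace E] [FiniteDimensional ℝ E]

theorem exists_ball_volume_lt [Nontrivial E] {η : ℝ≥0∞} (hη : η ≠ 0) :
    ∃ ρ > 0, volume (Metric.ball (0 : E) ρ) < η := by
  obtain ⟨U, hU, hUo, hlt⟩ := ({0} : Set E).exists_isOpen_lt_of_lt (μ := volume) η
    (by simpa [pos_iff_ne_zero] using hη)
  obtain ⟨ρ, hρ, hb⟩ := Metric.isOpen_iff.1 hUo 0 (hU rfl)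
  exact ⟨ρ, hρ, (measure_mono hb).trans_lt hlt⟩

theorem le_lintegral_indicator_sub {Q : Set E} (hQ : MeasurableSet Q) {δ : ℝ≥0∞} (hδ : δ ≠ ∞)
    (hδQ : δ ≤ volume Q) {ρ : ℝ} (hρ : volume (Metric.ball (0 : E) ρ) ≤ δ / 2) (x : E) :
    δ / 2 ≤ ∫⁻ w, {w : E | ρ ≤ ‖w‖ ∧ x - w ∈ Q}.indicator 1 w := by
  have hm : MeasurableSet {w : E | x - w ∈ Q} := (measurable_const.sub measurable_id) hQ
  have h1 : volume {w : E | x - w ∈ Q} = volume Q :=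
    (Measure.measurePreserving_sub_left volume x).measure_preimage hQ.nullMeasurableSet
  have h2 : {w : E | x - w ∈ Q} ⊆ {w : E | ρ ≤ ‖w‖ ∧ x - w ∈ Q} ∪ Metric.ball 0 ρ := fun w hw => by
    rcases le_or_gt ρ ‖w‖ with h | h
    · exact .inl ⟨h, hw⟩
    · exact .inr (mem_ball_zero_iff.2 h)
  have hm2 : MeasurableSet {w : E | ρ ≤ ‖w‖ ∧ x - w ∈ Q} :=
    (measurableSet_le measurable_const measurable_norm).inter hm
  rw [lintegral_indicator_one hm2]
  have h3 := (hδQ.trans_eq h1.symm).trans ((measure_mono h2).trans (measure_union_le _ _))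
  refine ENNReal.le_of_add_le_add_right (ENNReal.div_ne_top hδ two_ne_zero) ?_
  rw [ENNReal.add_halves]
  exact h3.trans (add_le_add le_rfl hρ)

/-- Substitute `w = τ • v`: the Jacobian is at least `2⁻ⁿ` for `τ ≤ 2`, and `ρ ≤ ‖w‖ ≤ 2L` confines
`v` to the annulus. Discarding `‖w‖ < ρ` costs at most `δ / 2` and keeps `v` away from `0`. -/
theorem le_lintegral_annulus {Q : Set E} (hQ : MeasurableSet Q) {L ρ : ℝ} (hρ : 0 < ρ)
    (hQL : Q ⊆ Metric.ball 0 L) {δ : ℝ≥0∞} (hδ : δ ≠ ∞) (hδQ : δ ≤ volume Q)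
    (hρδ : volume (Metric.ball (0 : E) ρ) ≤ δ / 2) {x : E} (hx : x ∈ Metric.ball 0 L) {τ : ℝ}
    (hτ : τ ∈ Icc (1 : ℝ) 2) :
    ENNReal.ofReal (2 ^ Module.finrank ℝ E)⁻¹ * (δ / 2) ≤
      ∫⁻ v in {v : E | ρ / 2 ≤ ‖v‖ ∧ ‖v‖ ≤ 2 * L}, {v : E | x - τ • v ∈ Q}.indicator 1 v := by
  have hτ0 : 0 < τ := one_pos.trans_le hτ.1
  have hm : MeasurableSet {w : E | x - w ∈ Q} := (measurable_const.sub measurable_id) hQ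
  have hm2 : MeasurableSet {w : E | ρ ≤ ‖w‖ ∧ x - w ∈ Q} :=
    (measurableSet_le measurable_const measurable_norm).inter hm
  have hV : MeasurableSet {v : E | ρ / 2 ≤ ‖v‖ ∧ ‖v‖ ≤ 2 * L} :=
    (measurableSet_le measurable_const measurable_norm).inter
      (measurableSet_le measurable_norm measurable_const)
  calc ENNReal.ofReal (2 ^ Module.finrank ℝ E)⁻¹ * (δ / 2)
      ≤ ENNReal.ofReal |(τ ^ Module.finrank ℝ E)⁻¹| *
          ∫⁻ w, {w : E | ρ ≤ ‖w‖ ∧ x - w ∈ Q}.indicator 1 w := by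
        refine mul_le_mul' (ENNReal.ofReal_le_ofReal ?_)
          (le_lintegral_indicator_sub hQ hδ hδQ hρδ x)
        rw [abs_of_pos (by positivity)]
        exact inv_anti₀ (by positivity) (pow_le_pow_left₀ hτ0.le hτ.2 _)
    _ = ∫⁻ v, {w : E | ρ ≤ ‖w‖ ∧ x - w ∈ Q}.indicator 1 (τ • v) :=
        (lintegral_comp_smul volume (measurable_one.indicator hm2) hτ0.ne').symm
    _ ≤ _ := by
        rw [← lintegral_indicator hV, indicator_indicator]
        refine lintegral_mono fun v => ?_
        by_cases hv : τ • v ∈ {w : E | ρ ≤ ‖w‖ ∧ x - w ∈ Q}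
        · rw [indicator_of_mem hv, indicator_of_mem]
          · simp
          obtain ⟨h1, h2⟩ := hv
          have h3 := mem_ball_zero_iff.1 (hQL h2)
          have h4 := mem_ball_zero_iff.1 hx
          have h5 : ‖τ • v‖ ≤ ‖x‖ + ‖x - τ • v‖ := by
            rw [← norm_neg (x - τ • v), neg_sub]
            simpa using norm_add_le x (τ • v - x)
          rw [norm_smul, Real.norm_of_nonneg hτ0.le] at h1 h5
          refine ⟨⟨?_, ?_⟩, h2⟩
          · nlinarith [hτ.2, norm_nonneg v]
          · nlinarith [hτ.1, norm_nonneg v]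
        · rw [indicator_of_notMem hv]; exact zero_le

/-- The points of `P` beyond the mirror that are reflected into `Q`. -/
def mirrorMatch (P Q : Set E) (v : E) (t : ℝ) : Set E :=
  {x ∈ P | 0 < mirrorCoord v t x ∧ mirror v t x ∈ Q}

theorem measurableSet_mirrorMatch_prod {P Q : Set E} (hP : MeasurableSet P)
    (hQ : MeasurableSet Q) :
    MeasurableSet {p : E × ℝ × E | p.2.2 ∈ mirrorMatch P Q p.1 p.2.1} := by
  have h1 : Measurable fun p : E × ℝ × E => mirrorCoord p.1 p.2.1 p.2.2 := by
    unfold mirrorCoord; fun_prop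
  have h2 : Measurable fun p : E × ℝ × E => mirror p.1 p.2.1 p.2.2 := by
    unfold mirror; fun_prop
  exact ((measurable_snd.comp measurable_snd) hP).inter
    ((measurableSet_lt measurable_const h1).inter (h2 hQ))

-- For fixed `x` and `v`, the offset `t = 2⟨x, v⟩/|v|² - τ` makes `τ` the mirror coordinate of `x`,
-- so `x` is reflected to `x - τ • v`. Since `|2⟨x, v⟩|/|v|² ≤ 4L/ρ` and `τ ≤ 2`, these offsets lie
-- in a fixed interval.
omit [MeasurableSpace E] [BorelSpace E] [FiniteDimensional ℝ E] in
theorem lintegral_offset_ge {P Q : Set E} {L ρ : ℝ} (hρ : 0 < ρ) {x v : E} (hxP : x ∈ P)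
    (hx : x ∈ Metric.ball 0 L) (hv : ρ / 2 ≤ ‖v‖) :
    ∫⁻ τ in Icc (1 : ℝ) 2, {v : E | x - τ • v ∈ Q}.indicator 1 v ≤
      ∫⁻ t in Icc (-(4 * L / ρ + 2)) (4 * L / ρ + 2),
        (mirrorMatch P Q v t).indicator (1 : E → ℝ≥0∞) x := by
  rw [← lintegral_indicator measurableSet_Icc, ← lintegral_indicator measurableSet_Icc,
    ← lintegral_sub_left_eq_self ((Icc _ _).indicator fun t =>
      (mirrorMatch P Q v t).indicator (1 : E → ℝ≥0∞) x) (2 * inner ℝ x v / ‖v‖ ^ 2)]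
  refine lintegral_mono fun τ => ?_
  dsimp only
  by_cases hτ : τ ∈ Icc (1 : ℝ) 2
  swap
  · rw [indicator_of_notMem hτ]; exact zero_le
  rw [indicator_of_mem hτ]
  by_cases hQ : x - τ • v ∈ Q
  swap
  · rw [indicator_of_notMem (show v ∉ {v : E | x - τ • v ∈ Q} from hQ)]; exact zero_le
  have hv0 : 0 < ‖v‖ := (half_pos hρ).trans_le hv
  have hτc : mirrorCoord v (2 * inner ℝ x v / ‖v‖ ^ 2 - τ) x = τ := by
    unfold mirrorCoord; ring
  have hmem : x ∈ mirrorMatch P Q v (2 * inner ℝ x v / ‖v‖ ^ 2 - τ) := by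
    refine ⟨hxP, ?_, ?_⟩
    · rw [hτc]; linarith [hτ.1]
    · rw [mirror, hτc]; exact hQ
  have hb : |2 * inner ℝ x v / ‖v‖ ^ 2| ≤ 4 * L / ρ := by
    have h1 := abs_real_inner_le_norm x v
    have h2 : ‖x‖ ≤ L := (mem_ball_zero_iff.1 hx).le
    rw [abs_div, abs_mul, abs_of_pos (two_pos : (0 : ℝ) < 2), abs_of_pos (pow_pos hv0 2),
      div_le_div_iff₀ (by positivity) hρ]
    have h3 : |inner ℝ x v| ≤ L * ‖v‖ := h1.trans (by gcongr)
    have hL : 0 ≤ L := (norm_nonneg x).trans h2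
    have h4 : L * ‖v‖ * ρ ≤ L * ‖v‖ * (2 * ‖v‖) := by gcongr; linarith
    nlinarith
  refine (indicator_le_self' (fun _ _ => zero_le) _).trans ?_
  rw [indicator_of_mem, indicator_of_mem hmem]
  · exact le_rfl
  · rw [abs_le] at hb
    exact ⟨by linarith [hτ.2], by linarith [hτ.1]⟩

theorem lintegral_volume_mirrorMatch_ge {P Q : Set E} (hP : MeasurableSet P)
    (hQ : MeasurableSet Q) {L ρ : ℝ} (hρ : 0 < ρ) (hPL : P ⊆ Metric.ball 0 L)
    (hQL : Q ⊆ Metric.ball 0 L) {δ : ℝ≥0∞} (hδ : δ ≠ ∞) (hδP : δ ≤ volume P) (hδQ : δ ≤ volume Q)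
    (hρδ : volume (Metric.ball (0 : E) ρ) ≤ δ / 2) :
    ENNReal.ofReal (2 ^ Module.finrank ℝ E)⁻¹ * (δ / 2) * δ ≤
      ∫⁻ v in {v : E | ρ / 2 ≤ ‖v‖ ∧ ‖v‖ ≤ 2 * L},
        ∫⁻ t in Icc (-(4 * L / ρ + 2)) (4 * L / ρ + 2), volume (mirrorMatch P Q v t) := by
  set V := {v : E | ρ / 2 ≤ ‖v‖ ∧ ‖v‖ ≤ 2 * L}
  set T := Icc (-(4 * L / ρ + 2)) (4 * L / ρ + 2)
  have hV : MeasurableSet V :=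
    (measurableSet_le measurable_const measurable_norm).inter
      (measurableSet_le measurable_norm measurable_const)
  have hm := measurableSet_mirrorMatch_prod hP hQ
  have hH : Measurable fun p : E × ℝ × E =>
      (mirrorMatch P Q p.1 p.2.1).indicator (1 : E → ℝ≥0∞) p.2.2 :=
    measurable_one.indicator hm
  have hS : ∀ v t, MeasurableSet (mirrorMatch P Q v t) := fun v t =>
    (measurable_const.prodMk (measurable_const.prodMk measurable_id) :
      Measurable fun x : E => (v, t, x)) hm
  calc ENNReal.ofReal (2 ^ Module.finrank ℝ E)⁻¹ * (δ / 2) * δ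
      ≤ ∫⁻ _ in P, ENNReal.ofReal (2 ^ Module.finrank ℝ E)⁻¹ * (δ / 2) := by
        rw [setLIntegral_const]; gcongr
    _ ≤ ∫⁻ x in P, ∫⁻ τ in Icc (1 : ℝ) 2, ∫⁻ v in V, {v : E | x - τ • v ∈ Q}.indicator 1 v := by
        refine setLIntegral_mono' hP fun x hx => ?_
        refine le_trans ?_ (setLIntegral_mono' measurableSet_Icc fun τ hτ =>
          le_lintegral_annulus hQ hρ hQL hδ hδQ hρδ (hPL hx) hτ)
        rw [setLIntegral_const, Real.volume_Icc]
        norm_num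
    _ = ∫⁻ x in P, ∫⁻ v in V, ∫⁻ τ in Icc (1 : ℝ) 2, {v : E | x - τ • v ∈ Q}.indicator 1 v := by
        refine lintegral_congr fun x => lintegral_lintegral_swap (Measurable.aemeasurable ?_)
        have : Measurable fun p : ℝ × E => x - p.1 • p.2 := by fun_prop
        exact measurable_one.indicator (this hQ)
    _ ≤ ∫⁻ x in P, ∫⁻ v in V, ∫⁻ t in T, (mirrorMatch P Q v t).indicator (1 : E → ℝ≥0∞) x :=
        setLIntegral_mono' hP fun x hx => setLIntegral_mono' hV fun v hv =>
          lintegral_offset_ge hρ hx (hPL hx) hv.1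
    _ ≤ ∫⁻ x, ∫⁻ v in V, ∫⁻ t in T, (mirrorMatch P Q v t).indicator (1 : E → ℝ≥0∞) x :=
        setLIntegral_le_lintegral _ _
    _ = ∫⁻ v in V, ∫⁻ x, ∫⁻ t in T, (mirrorMatch P Q v t).indicator (1 : E → ℝ≥0∞) x := by
        refine lintegral_lintegral_swap (Measurable.aemeasurable ?_)
        exact Measurable.lintegral_prod_right (f := fun (q : E × E) (t : ℝ) =>
          (mirrorMatch P Q q.2 t).indicator (1 : E → ℝ≥0∞) q.1)
          (hH.comp (by fun_prop : Measurable fun r : (E × E) × ℝ => (r.1.2, r.2, r.1.1)))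
    _ = ∫⁻ v in V, ∫⁻ t in T, ∫⁻ x, (mirrorMatch P Q v t).indicator (1 : E → ℝ≥0∞) x := by
        refine lintegral_congr fun v => lintegral_lintegral_swap (Measurable.aemeasurable ?_)
        exact hH.comp (by fun_prop : Measurable fun r : E × ℝ => (v, r.2, r.1))
    _ = _ := by simp only [lintegral_indicator_one (hS _ _)]

/-- Some hyperplane does at least as well as average over a parameter set of finite measure. The
constant must not depend on `P` and `Q`, since it is reused at every step of the iteration. -/
theorem exists_mirror_match [Nontrivial E] (L : ℝ) {δ : ℝ≥0∞} (hδ : δ ≠ 0) :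
    ∃ c : ℝ≥0∞, c ≠ 0 ∧ ∀ P Q : Set E, MeasurableSet P → MeasurableSet Q →
      P ⊆ Metric.ball 0 L → Q ⊆ Metric.ball 0 L → δ ≤ volume P → δ ≤ volume Q →
        ∃ (v : E) (t : ℝ), v ≠ 0 ∧ c ≤ volume (mirrorMatch P Q v t) := by
  wlog hδt : δ ≠ ∞ generalizing δ
  · obtain ⟨c, hc, h⟩ := this one_ne_zero ENNReal.one_ne_top
    have h1 : 1 ≤ δ := by rw [not_not.1 hδt]; exact le_top
    exact ⟨c, hc, fun P Q hP hQ hPL hQL hδP hδQ =>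
      h P Q hP hQ hPL hQL (h1.trans hδP) (h1.trans hδQ)⟩
  obtain ⟨ρ, hρ, hρδ⟩ := exists_ball_volume_lt (E := E) (ENNReal.half_pos hδ).ne'
  set V := {v : E | ρ / 2 ≤ ‖v‖ ∧ ‖v‖ ≤ 2 * L} with hVdef
  set T := Icc (-(4 * L / ρ + 2)) (4 * L / ρ + 2) with hTdef
  set N := volume T * volume V with hN
  have hV : MeasurableSet V :=
    (measurableSet_le measurable_const measurable_norm).inter
      (measurableSet_le measurable_norm measurable_const)
  have hVt : volume V ≠ ∞ := by
    refine ne_top_of_le_ne_top (measure_closedBall_lt_top (x := (0 : E)) (r := 2 * L)).ne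
      (measure_mono fun v hv => ?_)
    rw [mem_closedBall_zero_iff]; exact hv.2
  have hNt : N ≠ ∞ := ENNReal.mul_ne_top measure_Icc_lt_top.ne hVt
  set κ := ENNReal.ofReal (2 ^ Module.finrank ℝ E)⁻¹ * (δ / 2) * δ with hκ
  have hκ0 : κ ≠ 0 := by
    refine mul_ne_zero (mul_ne_zero ?_ (ENNReal.half_pos hδ).ne') hδ
    rw [Ne, ENNReal.ofReal_eq_zero, not_le]; positivity
  have hκt : κ ≠ ∞ := ENNReal.mul_ne_top (ENNReal.mul_ne_top ENNReal.ofReal_ne_top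
    (ENNReal.div_ne_top hδt two_ne_zero)) hδt
  -- Dividing by `N + 1` rather than `N` covers `N = 0` and makes the final comparison strict.
  have hN1 : N + 1 ≠ ∞ := ENNReal.add_ne_top.2 ⟨hNt, ENNReal.one_ne_top⟩
  have hc0 : κ / (N + 1) ≠ 0 := ENNReal.div_ne_zero.2 ⟨hκ0, hN1⟩
  refine ⟨κ / (N + 1), hc0, fun P Q hP hQ hPL hQL hδP hδQ => ?_⟩
  by_contra! hcon
  have h1 := lintegral_volume_mirrorMatch_ge hP hQ hρ hPL hQL hδt hδP hδQ hρδ.le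
  have h2 : ∫⁻ v in V, ∫⁻ t in T, volume (mirrorMatch P Q v t) ≤ κ / (N + 1) * N := by
    calc _ ≤ ∫⁻ v in V, ∫⁻ t in T, κ / (N + 1) := by
          refine setLIntegral_mono' hV fun v hv => lintegral_mono fun t => (hcon v t ?_).le
          exact norm_pos_iff.1 ((half_pos hρ).trans_le hv.1)
      _ = κ / (N + 1) * N := by rw [setLIntegral_const, setLIntegral_const, mul_assoc]
  have hct : κ / (N + 1) ≠ ∞ := ENNReal.div_ne_top hκt (by simp)
  have h3 : κ / (N + 1) * N < κ := by
    calc κ / (N + 1) * N < κ / (N + 1) * N + κ / (N + 1) :=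
          ENNReal.lt_add_right (ENNReal.mul_ne_top hct hNt) hc0
      _ = κ / (N + 1) * (N + 1) := by rw [mul_add, mul_one]
      _ = κ := ENNReal.div_mul_cancel (by simp) hN1
  exact (h1.trans h2).not_gt h3

end Averaging

/-! ### Riesz's inequality for two sets -/

theorem indicator_le_add_sdiff {α : Type*} (A A' : Set α) :
    A.indicator (1 : α → ℝ≥0∞) ≤ A'.indicator 1 + (A \ A').indicator 1 := fun x => by
  by_cases h : x ∈ A <;> by_cases h' : x ∈ A' <;> simp [h, h']

section Riesz

variable {E : Type*} [NormedAddCommGroup E] [InnerProductSpace ℝ E] [MeasurableSpace E]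
  [BorelSpace E] [FiniteDimensional ℝ E]

theorem kernelForm_mono {g : ℝ → ℝ≥0∞} {f f' h h' : E → ℝ≥0∞} (hf : f ≤ f') (hh : h ≤ h') :
    kernelForm g f h ≤ kernelForm g f' h' :=
  lintegral_mono fun x => lintegral_mono fun y => by
    have h1 := hf x
    have h2 := hh y
    dsimp only
    gcongr

theorem kernelForm_comm {g : ℝ → ℝ≥0∞} (hg : Measurable g) {f h : E → ℝ≥0∞} (hf : Measurable f)
    (hh : Measurable h) : kernelForm g f h = kernelForm g h f := by
  rw [kernelForm, lintegral_lintegral_swap (by fun_prop)]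
  refine lintegral_congr fun x => lintegral_congr fun y => ?_
  rw [norm_sub_rev, mul_comm (f y)]

theorem kernelForm_add_left {g : ℝ → ℝ≥0∞} (hg : Measurable g) {f f' h : E → ℝ≥0∞}
    (hf : Measurable f) (hh : Measurable h) :
    kernelForm g (f + f') h = kernelForm g f h + kernelForm g f' h := by
  unfold kernelForm
  rw [← lintegral_add_left (Measurable.lintegral_prod_right
    (f := fun x y => f x * h y * g ‖x - y‖) (by fun_prop))]
  refine lintegral_congr fun x => ?_
  rw [← lintegral_add_left (by fun_prop)]
  simp only [Pi.add_apply, add_mul]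

theorem kernelForm_indicator_le {g : ℝ → ℝ≥0∞} {X Y : Set E} (hX : MeasurableSet X) :
    kernelForm g (X.indicator 1) (Y.indicator 1) ≤ (∫⁻ z : E, g ‖z‖) * volume X := by
  calc kernelForm g (X.indicator 1) (Y.indicator 1)
      ≤ ∫⁻ x, (∫⁻ z : E, g ‖z‖) * X.indicator 1 x := by
        refine lintegral_mono fun x => ?_
        by_cases hx : x ∈ X
        · simp only [indicator_of_mem hx, Pi.one_apply, one_mul, mul_one]
          rw [← lintegral_sub_left_eq_self (fun z : E => g ‖z‖) x]
          refine lintegral_mono fun y => mul_le_of_le_one_left' ?_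
          exact indicator_le_self' (fun _ _ => zero_le) y
        · simp [indicator_of_notMem hx]
    _ = _ := by rw [lintegral_const_mul _ (measurable_one.indicator hX), lintegral_indicator_one hX]

/-- Stability in measure: a set of small volume interacts with any other set by at most its volume
times the mass of the kernel. -/
theorem kernelForm_indicator_le_add {g : ℝ → ℝ≥0∞} (hg : Measurable g) {A A' B B' : Set E}
    (hA : MeasurableSet A) (hA' : MeasurableSet A') (hB : MeasurableSet B)
    (hB' : MeasurableSet B') :
    kernelForm g (A.indicator 1) (B.indicator 1) ≤
      kernelForm g (A'.indicator 1) (B'.indicator 1) +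
        (∫⁻ z : E, g ‖z‖) * (volume (A \ A') + volume (B \ B')) := by
  have m : ∀ {S : Set E}, MeasurableSet S → Measurable (S.indicator (1 : E → ℝ≥0∞)) :=
    fun hS => measurable_one.indicator hS
  have h1 : kernelForm g (A.indicator 1) (B.indicator 1) ≤
      kernelForm g (A'.indicator 1) (B.indicator 1) + (∫⁻ z : E, g ‖z‖) * volume (A \ A') := by
    refine (kernelForm_mono (indicator_le_add_sdiff A A') le_rfl).trans ?_
    rw [kernelForm_add_left hg (m hA') (m hB)]
    exact add_le_add le_rfl (kernelForm_indicator_le (hA.diff hA'))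
  have h2 : kernelForm g (A'.indicator 1) (B.indicator 1) ≤
      kernelForm g (A'.indicator 1) (B'.indicator 1) + (∫⁻ z : E, g ‖z‖) * volume (B \ B') := by
    rw [kernelForm_comm hg (m hA') (m hB), kernelForm_comm hg (m hA') (m hB')]
    refine (kernelForm_mono (indicator_le_add_sdiff B B') le_rfl).trans ?_
    rw [kernelForm_add_left hg (m hB') (m hA')]
    exact add_le_add le_rfl (kernelForm_indicator_le (hB.diff hB'))
  refine h1.trans ((add_le_add h2 le_rfl).trans_eq ?_)
  rw [mul_add, add_assoc, add_comm (_ * volume (B \ B'))]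

theorem volume_sdiff_comm {A K : Set E} (hA : MeasurableSet A) (hK : MeasurableSet K)
    (hAt : volume A ≠ ∞) (h : volume A = volume K) : volume (K \ A) = volume (A \ K) := by
  have h1 := measure_inter_add_sdiff (μ := volume) A hK
  have h2 := measure_inter_add_sdiff (μ := volume) K hA
  rw [← h, ← h1, inter_comm K A] at h2
  exact (ENNReal.add_right_inj (measure_ne_top_of_subset inter_subset_left hAt)).1 h2

-- A reflection carrying a point from outside a centred ball into it shortens the norm, which a
-- negative `t` would forbid. The matching hyperplanes thus have the origin on the correct side.
omit [MeasurableSpace E] [BorelSpace E] [FiniteDimensional ℝ E] in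
theorem nonneg_of_mem_mirrorMatch {A : Set E} {r : ℝ} {v x : E} {t : ℝ} (hv : v ≠ 0)
    (hx : x ∈ mirrorMatch (A \ Metric.ball 0 r) (Metric.ball 0 r \ A) v t) : 0 ≤ t := by
  obtain ⟨⟨_, h1⟩, h2, h3, _⟩ := hx
  rw [mem_ball_zero_iff, not_lt] at h1
  rw [mem_ball_zero_iff] at h3
  have h4 := norm_mirror_sq hv t x
  have h5 : ‖mirror v t x‖ ^ 2 < ‖x‖ ^ 2 := pow_lt_pow_left₀ (h3.trans_le h1) (norm_nonneg _) two_ne_zero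
  by_contra! ht
  have : mirrorCoord v t x * t * ‖v‖ ^ 2 ≤ 0 :=
    mul_nonpos_of_nonpos_of_nonneg (mul_nonpos_of_nonneg_of_nonpos h2.le ht.le) (by positivity)
  linarith

/-- The pair `(A', B')` consists of sets in `B(0, L)` with the volumes of `A` and `B`, and its
interaction is at least that of `(A, B)`. -/
structure IsImprovement (g : ℝ → ℝ≥0∞) (L : ℝ) (A B A' B' : Set E) : Prop where
  measurableSet_left : MeasurableSet A'
  measurableSet_right : MeasurableSet B'
  subset_left : A' ⊆ Metric.ball 0 L
  subset_right : B' ⊆ Metric.ball 0 L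
  volume_left : volume A' = volume A
  volume_right : volume B' = volume B
  kernelForm_le : kernelForm g (A.indicator 1) (B.indicator 1) ≤
    kernelForm g (A'.indicator 1) (B'.indicator 1)

theorem IsImprovement.polarize {g : ℝ → ℝ≥0∞} (hg : Measurable g)
    (hanti : ∀ ⦃r r' : ℝ⦄, 0 ≤ r → r ≤ r' → g r' ≤ g r) {L : ℝ} {A B A' B' : Set E}
    (h : IsImprovement g L A B A' B') {v : E} (hv : v ≠ 0) {t : ℝ} (ht : 0 ≤ t) :
    IsImprovement g L A B (polarize v t A') (polarize v t B') where
  measurableSet_left := measurableSet_polarize v t h.1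
  measurableSet_right := measurableSet_polarize v t h.2
  subset_left := polarize_subset_ball hv ht h.3
  subset_right := polarize_subset_ball hv ht h.4
  volume_left := (volume_polarize hv t h.1).trans h.5
  volume_right := (volume_polarize hv t h.2).trans h.6
  kernelForm_le := h.7.trans (kernelForm_le_polarize hv t hg hanti h.1 h.2)

theorem volume_inter_ball_le {v : E} (hv : v ≠ 0) {t : ℝ} (ht : 0 ≤ t) {A : Set E}
    (hA : MeasurableSet A) (r : ℝ) :
    volume (A ∩ Metric.ball 0 r) ≤ volume (polarize v t A ∩ Metric.ball 0 r) :=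
  le_self_add.trans (volume_inter_ball_add_le hv ht hA r)

/-- While one set exceeds the tolerance `η`, some polarization adds at least `c` to its part in its
ball, and the same polarization does not reduce the other set's part. The total is bounded by
`volume A + volume B`, so this must stop. -/
theorem exists_improvement_sdiff_le [Nontrivial E] {g : ℝ → ℝ≥0∞} (hg : Measurable g)
    (hanti : ∀ ⦃r r' : ℝ⦄, 0 ≤ r → r ≤ r' → g r' ≤ g r) {A B : Set E} (hA : MeasurableSet A)
    (hB : MeasurableSet B) {L a b : ℝ} (hAL : A ⊆ Metric.ball 0 L) (hBL : B ⊆ Metric.ball 0 L)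
    (ha : volume (Metric.ball (0 : E) a) = volume A) (hb : volume (Metric.ball (0 : E) b) = volume B)
    (haL : a ≤ L) (hbL : b ≤ L) {η : ℝ≥0∞} (hη : η ≠ 0) :
    ∃ A' B', IsImprovement g L A B A' B' ∧ volume (A' \ Metric.ball 0 a) ≤ η ∧
      volume (B' \ Metric.ball 0 b) ≤ η := by
  obtain ⟨c, hc, hmatch⟩ := exists_mirror_match (E := E) L hη
  have hAt : volume A ≠ ∞ := ha ▸ measure_ball_lt_top.ne
  have hBt : volume B ≠ ∞ := hb ▸ measure_ball_lt_top.ne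
  have hK : ∀ r, MeasurableSet (Metric.ball (0 : E) r) := fun r => Metric.isOpen_ball.measurableSet
  have key : ∀ (X : Set E) (r : ℝ), MeasurableSet X → X ⊆ Metric.ball 0 L → r ≤ L →
      volume X ≠ ∞ → volume X = volume (Metric.ball (0 : E) r) →
      ¬ volume (X \ Metric.ball 0 r) ≤ η → ∃ (v : E) (t : ℝ), v ≠ 0 ∧ 0 ≤ t ∧
        volume (X ∩ Metric.ball 0 r) + c ≤ volume (Rearrangement.polarize v t X ∩ Metric.ball 0 r) := by
    intro X r hX hXL hrL hXt hXv hn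
    obtain ⟨v, t, hv, hvt⟩ := hmatch (X \ Metric.ball 0 r) (Metric.ball 0 r \ X)
      (hX.diff (hK r)) ((hK r).diff hX) (sdiff_subset.trans hXL)
      (sdiff_subset.trans (Metric.ball_subset_ball hrL)) (not_le.1 hn).le
      (by rw [volume_sdiff_comm hX (hK r) hXt hXv]; exact (not_le.1 hn).le)
    obtain ⟨x, hx⟩ := nonempty_of_measure_ne_zero ((pos_iff_ne_zero.2 hc).trans_le hvt).ne'
    have ht := nonneg_of_mem_mirrorMatch hv hx
    exact ⟨v, t, hv, ht, (add_le_add le_rfl hvt).trans (volume_inter_ball_add_le hv ht hX r)⟩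
  by_contra! hcon
  have hstep : ∀ n : ℕ, ∃ A' B', IsImprovement g L A B A' B' ∧
      n * c ≤ volume (A' ∩ Metric.ball 0 a) + volume (B' ∩ Metric.ball 0 b) := by
    intro n
    induction n with
    | zero => exact ⟨A, B, ⟨hA, hB, hAL, hBL, rfl, rfl, le_rfl⟩, by simp⟩
    | succ n ih =>
      obtain ⟨A', B', h, hn⟩ := ih
      by_cases h1 : volume (A' \ Metric.ball 0 a) ≤ η
      · obtain ⟨v, t, hv, ht, hle⟩ := key B' b h.2 h.4 hbL (h.6 ▸ hBt) (h.6.trans hb.symm)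
          (hcon A' B' h h1).not_ge
        refine ⟨_, _, h.polarize hg hanti hv ht, ?_⟩
        have h2 := volume_inter_ball_le hv ht h.1 a
        rw [Nat.cast_succ, add_mul, one_mul]
        refine (add_le_add hn le_rfl).trans ?_
        rw [add_assoc]
        exact add_le_add h2 hle
      · obtain ⟨v, t, hv, ht, hle⟩ := key A' a h.1 h.3 haL (h.5 ▸ hAt) (h.5.trans ha.symm) h1
        refine ⟨_, _, h.polarize hg hanti hv ht, ?_⟩
        have h2 := volume_inter_ball_le hv ht h.2 b
        rw [Nat.cast_succ, add_mul, one_mul]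
        refine (add_le_add hn le_rfl).trans ?_
        rw [add_right_comm]
        exact add_le_add hle h2
  obtain ⟨n, hn⟩ := ENNReal.exists_nat_mul_gt hc (ENNReal.add_ne_top.2 ⟨hAt, hBt⟩)
  obtain ⟨A', B', h, hle⟩ := hstep n
  refine absurd (hn.trans_le hle) (not_lt.2 ?_)
  exact add_le_add ((measure_mono inter_subset_left).trans_eq h.5)
    ((measure_mono inter_subset_left).trans_eq h.6)

theorem le_of_forall_le_add_mul {x y k : ℝ≥0∞} (hk : k ≠ ∞)
    (h : ∀ η : ℝ≥0∞, η ≠ 0 → x ≤ y + k * (η + η)) : x ≤ y := by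
  refine ENNReal.le_of_forall_pos_le_add fun ε hε _ => ?_
  have hk1 : 2 * (k + 1) ≠ ∞ := ENNReal.mul_ne_top (by simp) (by simp [hk])
  refine (h (ε / (2 * (k + 1))) (ENNReal.div_ne_zero.2 ⟨by simpa using hε.ne', hk1⟩)).trans ?_
  gcongr
  calc k * (ε / (2 * (k + 1)) + ε / (2 * (k + 1)))
      ≤ (k + 1) * (ε / (2 * (k + 1)) + ε / (2 * (k + 1))) := by gcongr; exact le_self_add
    _ = ε / (2 * (k + 1)) * (2 * (k + 1)) := by ring
    _ = ε := ENNReal.div_mul_cancel (by simp) hk1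

theorem kernelForm_indicator_le_ball [Nontrivial E] {g : ℝ → ℝ≥0∞} (hg : Measurable g)
    (hanti : ∀ ⦃r r' : ℝ⦄, 0 ≤ r → r ≤ r' → g r' ≤ g r) (hgt : ∫⁻ z : E, g ‖z‖ ≠ ∞) {A B : Set E}
    (hA : MeasurableSet A) (hB : MeasurableSet B) {L a b : ℝ} (hAL : A ⊆ Metric.ball 0 L)
    (hBL : B ⊆ Metric.ball 0 L) (ha : volume (Metric.ball (0 : E) a) = volume A)
    (hb : volume (Metric.ball (0 : E) b) = volume B) :
    kernelForm g (A.indicator 1) (B.indicator 1) ≤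
      kernelForm g ((Metric.ball (0 : E) a).indicator 1) ((Metric.ball (0 : E) b).indicator 1) := by
  refine le_of_forall_le_add_mul hgt fun η hη => ?_
  have hL := le_max_left L (max a b)
  obtain ⟨A', B', h, h1, h2⟩ := exists_improvement_sdiff_le hg hanti hA hB
    (L := max L (max a b)) (hAL.trans (Metric.ball_subset_ball hL))
    (hBL.trans (Metric.ball_subset_ball hL)) ha hb
    ((le_max_left a b).trans (le_max_right L _)) ((le_max_right a b).trans (le_max_right L _)) hη
  refine h.7.trans ((kernelForm_indicator_le_add hg h.1 (A' := Metric.ball 0 a)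
    Metric.isOpen_ball.measurableSet h.2 (B' := Metric.ball 0 b)
    Metric.isOpen_ball.measurableSet).trans ?_)
  gcongr

theorem exists_volume_sdiff_ball_le {A : Set E} (hA : MeasurableSet A) (hAt : volume A ≠ ∞)
    {η : ℝ≥0∞} (hη : η ≠ 0) : ∃ N : ℕ, ∀ n ≥ N, volume (A \ Metric.ball 0 (n : ℝ)) ≤ η := by
  have h := tendsto_measure_iInter_atTop (μ := volume) (s := fun n : ℕ => A \ Metric.ball 0 (n : ℝ))
    (fun n => (hA.diff Metric.isOpen_ball.measurableSet).nullMeasurableSet)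
    (fun m n hmn => sdiff_subset_sdiff_right (Metric.ball_subset_ball (Nat.cast_le.2 hmn)))
    ⟨0, measure_ne_top_of_subset sdiff_subset hAt⟩
  have he : ⋂ n : ℕ, A \ Metric.ball 0 (n : ℝ) = ∅ := by
    refine eq_empty_of_forall_notMem fun x hx => ?_
    obtain ⟨n, hn⟩ := exists_nat_gt ‖x‖
    exact (mem_iInter.1 hx n).2 (mem_ball_zero_iff.2 hn)
  rw [he, measure_empty] at h
  exact Filter.eventually_atTop.1 ((tendsto_order.1 h).2 η (pos_iff_ne_zero.2 hη) |>.mono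
    fun _ => le_of_lt)

end Riesz

theorem setRearr_mono {d : ℕ} {A B : Set (Space d)} (h : volume A ≤ volume B)
    (hB : volume B ≠ ∞) : setRearr A ⊆ setRearr B := by
  refine Metric.ball_subset_ball (Real.rpow_le_rpow ENNReal.toReal_nonneg
    (ENNReal.toReal_mono (ENNReal.div_ne_top hB ?_) (by gcongr)) (by positivity))
  exact (Metric.measure_ball_pos volume _ one_pos).ne'

theorem measurableSet_setRearr {d : ℕ} (A : Set (Space d)) : MeasurableSet (setRearr A) :=
  Metric.isOpen_ball.measurableSet

/-- The Riesz rearrangement inequality for two sets and a radially decreasing kernel. -/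
theorem kernelForm_le_setRearr {d : ℕ} (hd : 1 ≤ d) {g : ℝ → ℝ≥0∞} (hg : Measurable g)
    (hanti : ∀ ⦃r r' : ℝ⦄, 0 ≤ r → r ≤ r' → g r' ≤ g r) (hgt : ∫⁻ z : Space d, g ‖z‖ ≠ ∞)
    {A B : Set (Space d)} (hA : MeasurableSet A) (hB : MeasurableSet B) (hAt : volume A ≠ ∞)
    (hBt : volume B ≠ ∞) :
    kernelForm g (A.indicator 1) (B.indicator 1) ≤
      kernelForm g ((setRearr A).indicator 1) ((setRearr B).indicator 1) := by
  have : Nonempty (Fin d) := ⟨⟨0, hd⟩⟩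
  have : Nontrivial (Space d) := by infer_instance
  refine le_of_forall_le_add_mul hgt fun η hη => ?_
  -- The two-set inequality is known for bounded sets: truncate to a large ball, losing at most `η`
  -- of each volume, and enlarge the resulting balls by monotonicity.
  obtain ⟨m, hm⟩ := exists_volume_sdiff_ball_le hA hAt hη
  obtain ⟨n, hn⟩ := exists_volume_sdiff_ball_le hB hBt hη
  set N := max m n
  have hball : MeasurableSet (Metric.ball (0 : Space d) (N : ℝ)) := Metric.isOpen_ball.measurableSet
  have h1 : ∀ S : Set (Space d), volume (S ∩ Metric.ball 0 (N : ℝ)) ≤ volume S := fun S =>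
    measure_mono inter_subset_left
  have h2 : ∀ {S : Set (Space d)}, volume S ≠ ∞ →
      (setRearr (S ∩ Metric.ball 0 (N : ℝ))).indicator (1 : Space d → ℝ≥0∞) ≤
        (setRearr S).indicator 1 := fun hS =>
    indicator_le_indicator_of_subset (setRearr_mono (h1 _) hS) fun _ => zero_le
  have h3 : ∀ {S : Set (Space d)}, volume S ≠ ∞ →
      volume (setRearr (S ∩ Metric.ball 0 (N : ℝ))) = volume (S ∩ Metric.ball 0 (N : ℝ)) :=
    fun hS => volume_setRearr hd _ (ne_top_of_le_ne_top hS (h1 _))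
  refine (kernelForm_indicator_le_add hg hA (hA.inter hball) hB (hB.inter hball)).trans ?_
  rw [sdiff_self_inter, sdiff_self_inter]
  refine add_le_add ?_ ?_
  · exact (kernelForm_indicator_le_ball hg hanti hgt (hA.inter hball) (hB.inter hball)
      inter_subset_right inter_subset_right (h3 hAt) (h3 hBt)).trans
      (kernelForm_mono (h2 hAt) (h2 hBt))
  · gcongr
    · exact hm N (le_max_left _ _)
    · exact hn N (le_max_right _ _)

/-! ### Layer-cake decomposition: from sets to functions -/

section LayerCake

variable {d : ℕ}

theorem kernelForm_lintegral_left {g : ℝ → ℝ≥0∞} (hg : Measurable g) {μ : Measure ℝ} [SFinite μ]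
    {α : ℝ → Space d → ℝ≥0∞} (hα : Measurable (Function.uncurry α)) {h : Space d → ℝ≥0∞}
    (hh : Measurable h) :
    kernelForm g (fun x => ∫⁻ s, α s x ∂μ) h = ∫⁻ s, kernelForm g (α s) h ∂μ := by
  have hα' : ∀ x, Measurable fun s => α s x := fun x => hα.comp measurable_prodMk_right
  have e : ∀ (c : ℝ≥0∞) (x : Space d), ∫⁻ y, c * h y * g ‖x - y‖ =
      c * ∫⁻ y, h y * g ‖x - y‖ := fun c x => by
    rw [← lintegral_const_mul _ (by fun_prop)]
    simp only [mul_assoc]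
  have hk : Measurable fun x => ∫⁻ y, h y * g ‖x - y‖ :=
    Measurable.lintegral_prod_right (f := fun x y => h y * g ‖x - y‖) (by fun_prop)
  simp only [kernelForm, e]
  calc ∫⁻ x, (∫⁻ s, α s x ∂μ) * ∫⁻ y, h y * g ‖x - y‖
      = ∫⁻ x, ∫⁻ s, (α s x * ∫⁻ y, h y * g ‖x - y‖) ∂μ :=
        lintegral_congr fun x => (lintegral_mul_const _ (hα' x)).symm
    _ = _ := lintegral_lintegral_swap
        ((hα.comp measurable_swap).mul (hk.comp measurable_fst)).aemeasurable

theorem kernelForm_lintegral_self {g : ℝ → ℝ≥0∞} (hg : Measurable g) {μ : Measure ℝ} [SFinite μ]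
    {α : ℝ → Space d → ℝ≥0∞} (hα : Measurable (Function.uncurry α)) :
    kernelForm g (fun x => ∫⁻ s, α s x ∂μ) (fun x => ∫⁻ s, α s x ∂μ) =
      ∫⁻ s, ∫⁻ t, kernelForm g (α t) (α s) ∂μ ∂μ := by
  have hα' : ∀ s, Measurable (α s) := fun s => hα.comp measurable_prodMk_left
  have hF : Measurable fun x => ∫⁻ s, α s x ∂μ := hα.lintegral_prod_left'
  rw [kernelForm_lintegral_left hg hα hF]
  refine lintegral_congr fun s => ?_
  rw [kernelForm_comm hg (hα' s) hF, kernelForm_lintegral_left hg hα (hα' s)]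

theorem lintegral_lintegral_sq {μ : Measure ℝ} [SFinite μ] {α : ℝ → Space d → ℝ≥0∞}
    (hα : Measurable (Function.uncurry α)) :
    ∫⁻ x, (∫⁻ s, α s x ∂μ) ^ 2 = ∫⁻ s, ∫⁻ t, (∫⁻ x, α s x * α t x) ∂μ ∂μ := by
  have hα' : ∀ x, Measurable fun s => α s x := fun x => hα.comp measurable_prodMk_right
  have hα'' : ∀ s, Measurable (α s) := fun s => hα.comp measurable_prodMk_left
  have hF : Measurable fun x => ∫⁻ s, α s x ∂μ := hα.lintegral_prod_left'
  calc ∫⁻ x, (∫⁻ s, α s x ∂μ) ^ 2 = ∫⁻ x, ∫⁻ s, (α s x * ∫⁻ t, α t x ∂μ) ∂μ :=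
        lintegral_congr fun x => by rw [lintegral_mul_const _ (hα' x), sq]
    _ = ∫⁻ s, (∫⁻ x, α s x * ∫⁻ t, α t x ∂μ) ∂μ := by
        rw [lintegral_lintegral_swap]
        exact ((hα.comp measurable_swap).mul (hF.comp measurable_fst)).aemeasurable
    _ = ∫⁻ s, (∫⁻ x, ∫⁻ t, α s x * α t x ∂μ) ∂μ :=
        lintegral_congr fun s => lintegral_congr fun x => (lintegral_const_mul _ (hα' x)).symm
    _ = _ := lintegral_congr fun s => by
        rw [lintegral_lintegral_swap]
        exact (((hα'' s).comp measurable_fst).mul (hα.comp measurable_swap)).aemeasurable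

/-- The superlevel sets of `|φ|`. -/
def superlevel (φ : Space d → ℂ) (t : ℝ) : Set (Space d) := {y | t < ‖φ y‖}

theorem superlevel_anti (φ : Space d → ℂ) : Antitone (superlevel φ) :=
  fun _ _ hst _ hx => lt_of_le_of_lt hst hx

theorem measurable_superlevel {φ : Space d → ℂ} (hφ : Measurable φ) :
    Measurable (Function.uncurry fun t => (superlevel φ t).indicator (1 : Space d → ℝ≥0∞)) := by
  have h : MeasurableSet {p : ℝ × Space d | p.1 < ‖φ p.2‖} :=
    measurableSet_lt measurable_fst (hφ.comp measurable_snd).norm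
  exact measurable_one.indicator h

theorem measurableSet_superlevel {φ : Space d → ℂ} (hφ : Measurable φ) (t : ℝ) :
    MeasurableSet (superlevel φ t) :=
  measurableSet_lt measurable_const hφ.norm

theorem measurable_setRearr_superlevel (φ : Space d → ℂ) :
    Measurable (Function.uncurry fun t =>
      (setRearr (superlevel φ t)).indicator (1 : Space d → ℝ≥0∞)) := by
  have h1 : Measurable fun t => volume (superlevel φ t) :=
    Antitone.measurable fun s t hst => measure_mono (superlevel_anti φ hst)
  have h : MeasurableSet {p : ℝ × Space d | dist p.2 0 < (volume (superlevel φ p.1) /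
      volume (Metric.ball (0 : Space d) 1)).toReal ^ (1 / (d : ℝ))} :=
    measurableSet_lt (by fun_prop)
      (((h1.comp measurable_fst).div_const _).ennreal_toReal.pow_const _)
  exact measurable_one.indicator h

theorem symmRearr_eq (φ : Space d → ℂ) : symmRearr φ =
    fun x => ∫⁻ t in Ioi (0 : ℝ), (setRearr (superlevel φ t)).indicator 1 x := rfl

theorem measurable_symmRearr (φ : Space d → ℂ) : Measurable (symmRearr φ) := by
  rw [symmRearr_eq]
  exact (measurable_setRearr_superlevel φ).lintegral_prod_left'

theorem enorm_eq_lintegral_superlevel (φ : Space d → ℂ) :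
    (fun x => ‖φ x‖ₑ) = fun x => ∫⁻ t in Ioi (0 : ℝ), (superlevel φ t).indicator 1 x := by
  funext x
  have h : ∀ t : ℝ, (superlevel φ t).indicator (1 : Space d → ℝ≥0∞) x =
      (Iio ‖φ x‖).indicator 1 t := fun t => rfl
  simp only [h]
  rw [lintegral_indicator_one measurableSet_Iio, Measure.restrict_apply measurableSet_Iio,
    inter_comm, Ioi_inter_Iio, Real.volume_Ioo, sub_zero, ofReal_norm]

theorem volume_superlevel_ne_top {φ : Space d → ℂ} (hφ : Measurable φ)
    (h2 : ∫⁻ x, ‖φ x‖ₑ ^ 2 ≠ ∞) {t : ℝ} (ht : 0 < t) : volume (superlevel φ t) ≠ ∞ := by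
  have h0 : ENNReal.ofReal t ^ 2 ≠ 0 := by simpa using ht
  have h1 := meas_ge_le_lintegral_div (μ := volume) (f := fun x => ‖φ x‖ₑ ^ 2)
    (hφ.enorm.pow_const 2).aemeasurable h0 (by simp)
  refine ne_top_of_le_ne_top (ENNReal.div_ne_top h2 h0) ((measure_mono fun x hx => ?_).trans h1)
  have hx' : t < ‖φ x‖ := hx
  change ENNReal.ofReal t ^ 2 ≤ ‖φ x‖ₑ ^ 2
  rw [← ofReal_norm]
  gcongr

/-- Superlevel sets are nested, and so are their balls; both intersections are the smaller member.
This is why the L² norm is preserved. -/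
theorem volume_setRearr_inter (hd : 1 ≤ d) {φ : Space d → ℂ} (hφ : Measurable φ)
    (h2 : ∫⁻ x, ‖φ x‖ₑ ^ 2 ≠ ∞) {s t : ℝ} (hs : 0 < s) (ht : 0 < t) :
    volume (setRearr (superlevel φ s) ∩ setRearr (superlevel φ t)) =
      volume (superlevel φ s ∩ superlevel φ t) := by
  wlog hst : s ≤ t generalizing s t
  · rw [inter_comm, this ht hs (le_of_not_ge hst), inter_comm]
  have h := superlevel_anti φ hst
  rw [inter_eq_right.2 h, inter_eq_right.2 (setRearr_mono (measure_mono h)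
    (volume_superlevel_ne_top hφ h2 hs)), volume_setRearr hd _ (volume_superlevel_ne_top hφ h2 ht)]

theorem lintegral_symmRearr_sq (hd : 1 ≤ d) {φ : Space d → ℂ} (hφ : Measurable φ)
    (h2 : ∫⁻ x, ‖φ x‖ₑ ^ 2 ≠ ∞) : ∫⁻ x, symmRearr φ x ^ 2 = ∫⁻ x, ‖φ x‖ₑ ^ 2 := by
  have h := enorm_eq_lintegral_superlevel φ
  have h' : ∀ x, ‖φ x‖ₑ = ∫⁻ t in Ioi (0 : ℝ), (superlevel φ t).indicator 1 x := congrFun h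
  simp only [h', symmRearr_eq]
  rw [lintegral_lintegral_sq (measurable_setRearr_superlevel φ),
    lintegral_lintegral_sq (measurable_superlevel hφ)]
  refine setLIntegral_congr_fun measurableSet_Ioi fun s hs =>
    setLIntegral_congr_fun measurableSet_Ioi fun t ht => ?_
  have e : ∀ (A B : Set (Space d)) (x : Space d), A.indicator (1 : Space d → ℝ≥0∞) x *
      B.indicator 1 x = (A ∩ B).indicator 1 x := fun A B x => by
    rw [inter_indicator_one, Pi.mul_apply]
  simp only [e]
  rw [lintegral_indicator_one ((measurableSet_setRearr _).inter (measurableSet_setRearr _)),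
    lintegral_indicator_one ((measurableSet_superlevel hφ s).inter (measurableSet_superlevel hφ t)),
    volume_setRearr_inter hd hφ h2 hs ht]

/-- The Riesz rearrangement inequality for the function `|φ|` and a radially decreasing kernel. -/
theorem kernelForm_le_symmRearr (hd : 1 ≤ d) {g : ℝ → ℝ≥0∞} (hg : Measurable g)
    (hanti : ∀ ⦃r r' : ℝ⦄, 0 ≤ r → r ≤ r' → g r' ≤ g r) (hgt : ∫⁻ z : Space d, g ‖z‖ ≠ ∞)
    {φ : Space d → ℂ} (hφ : Measurable φ) (h2 : ∫⁻ x, ‖φ x‖ₑ ^ 2 ≠ ∞) :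
    kernelForm g (fun x => ‖φ x‖ₑ) (fun x => ‖φ x‖ₑ) ≤
      kernelForm g (symmRearr φ) (symmRearr φ) := by
  rw [enorm_eq_lintegral_superlevel, symmRearr_eq,
    kernelForm_lintegral_self hg (measurable_superlevel hφ),
    kernelForm_lintegral_self hg (measurable_setRearr_superlevel φ)]
  exact setLIntegral_mono' measurableSet_Ioi fun s hs =>
    setLIntegral_mono' measurableSet_Ioi fun t ht =>
      kernelForm_le_setRearr hd hg hanti hgt (measurableSet_superlevel hφ t)
        (measurableSet_superlevel hφ s) (volume_superlevel_ne_top hφ h2 ht)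
        (volume_superlevel_ne_top hφ h2 hs)

theorem measurable_symmRearrFun (φ : Space d → ℂ) : Measurable (symmRearrFun φ) :=
  Complex.measurable_ofReal.comp (measurable_symmRearr φ).ennreal_toReal

/-- A finite L² norm forces `symmRearr φ` to be finite almost everywhere, so `toReal` loses nothing
there. -/
theorem enorm_symmRearrFun (hd : 1 ≤ d) {φ : Space d → ℂ} (hφ : Measurable φ)
    (h2 : ∫⁻ x, ‖φ x‖ₑ ^ 2 ≠ ∞) : ∀ᵐ x, ‖symmRearrFun φ x‖ₑ = symmRearr φ x := by
  have h := ae_lt_top ((measurable_symmRearr φ).pow_const 2)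
    ((lintegral_symmRearr_sq hd hφ h2).trans_ne h2)
  filter_upwards [h] with x hx
  have hx' : symmRearr φ x ≠ ∞ := fun h => by simp [h] at hx
  rw [symmRearrFun, ← ofReal_norm, Complex.norm_real, Real.norm_of_nonneg ENNReal.toReal_nonneg,
    ENNReal.ofReal_toReal hx']

theorem lintegral_symmRearrFun_sq (hd : 1 ≤ d) {φ : Space d → ℂ} (hφ : Measurable φ)
    (h2 : ∫⁻ x, ‖φ x‖ₑ ^ 2 ≠ ∞) : ∫⁻ x, ‖symmRearrFun φ x‖ₑ ^ 2 = ∫⁻ x, ‖φ x‖ₑ ^ 2 := by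
  rw [← lintegral_symmRearr_sq hd hφ h2]
  refine lintegral_congr_ae ?_
  filter_upwards [enorm_symmRearrFun hd hφ h2] with x hx
  rw [hx]

theorem memLp_symmRearrFun (hd : 1 ≤ d) {φ : Space d → ℂ} (hφ : Measurable φ)
    (h2 : ∫⁻ x, ‖φ x‖ₑ ^ 2 ≠ ∞) : MemLp (symmRearrFun φ) 2 := by
  refine ⟨(measurable_symmRearrFun φ).aestronglyMeasurable, ?_⟩
  rw [eLpNorm_lt_top_iff_lintegral_rpow_enorm_lt_top two_ne_zero ENNReal.ofNat_ne_top]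
  simp only [ENNReal.toReal_ofNat, ENNReal.rpow_ofNat]
  rw [lintegral_symmRearrFun_sq hd hφ h2]
  exact h2.lt_top

end LayerCake

/-! ### Energy comparison -/

section Energy

variable {d : ℕ}

theorem kernelForm_congr_ae {g : ℝ → ℝ≥0∞} {f f' h h' : Space d → ℝ≥0∞} (hf : f =ᵐ[volume] f')
    (hh : h =ᵐ[volume] h') : kernelForm g f h = kernelForm g f' h' := by
  refine lintegral_congr_ae ?_
  filter_upwards [hf] with x hx
  refine lintegral_congr_ae ?_
  filter_upwards [hh] with y hy
  rw [hx, hy]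

theorem differenceEnergy_congr_ae {g : ℝ → ℝ≥0∞} {f f' : Space d → ℂ} (hf : f =ᵐ[volume] f') :
    differenceEnergy g f = differenceEnergy g f' := by
  refine lintegral_congr_ae ?_
  filter_upwards [hf] with x hx
  refine lintegral_congr_ae ?_
  filter_upwards [hf] with y hy
  rw [hx, hy]

/-- This is `(|a| - |b|)² ≤ |a - b|²`, written without subtraction of extended numbers. For
nonnegative reals it is an equality, so only the original function incurs a loss. -/
theorem enorm_sq_add_le (a b : ℂ) :
    ‖a‖ₑ ^ 2 + ‖b‖ₑ ^ 2 ≤ ‖a - b‖ₑ ^ 2 + 2 * (‖a‖ₑ * ‖b‖ₑ) := by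
  have h := sq_le_sq' (by linarith [abs_norm_sub_norm_le a b, neg_abs_le (‖a‖ - ‖b‖)])
    ((le_abs_self _).trans (abs_norm_sub_norm_le a b))
  rw [← ENNReal.ofReal_ofNat]
  simp only [← ofReal_norm, ← ENNReal.ofReal_pow (norm_nonneg _),
    ← ENNReal.ofReal_mul (norm_nonneg _), ← ENNReal.ofReal_mul (zero_le_two (α := ℝ))]
  rw [← ENNReal.ofReal_add (by positivity) (by positivity),
    ← ENNReal.ofReal_add (by positivity) (by positivity)]
  exact ENNReal.ofReal_le_ofReal (by nlinarith)

theorem enorm_sq_add_eq {a b : ℝ} (ha : 0 ≤ a) (hb : 0 ≤ b) :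
    ‖(a : ℂ)‖ₑ ^ 2 + ‖(b : ℂ)‖ₑ ^ 2 =
      ‖(a : ℂ) - (b : ℂ)‖ₑ ^ 2 + 2 * (‖(a : ℂ)‖ₑ * ‖(b : ℂ)‖ₑ) := by
  rw [← ENNReal.ofReal_ofNat, ← Complex.ofReal_sub]
  simp only [← ofReal_norm, ← ENNReal.ofReal_pow (norm_nonneg _),
    ← ENNReal.ofReal_mul (norm_nonneg _), ← ENNReal.ofReal_mul (zero_le_two (α := ℝ))]
  rw [← ENNReal.ofReal_add (by positivity) (by positivity),
    ← ENNReal.ofReal_add (by positivity) (by positivity)]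
  simp only [Complex.norm_real, Real.norm_eq_abs, sq_abs, abs_of_nonneg ha, abs_of_nonneg hb]
  congr 1
  ring

theorem lintegral_lintegral_kernel_mul_add {g : ℝ → ℝ≥0∞} (hg : Measurable g) {f : Space d → ℝ≥0∞}
    (hf : Measurable f) : ∫⁻ x, ∫⁻ y, g ‖x - y‖ * (f x + f y) =
      2 * ((∫⁻ z : Space d, g ‖z‖) * ∫⁻ x, f x) := by
  have h1 : ∫⁻ x, ∫⁻ y, g ‖x - y‖ * f x = (∫⁻ z : Space d, g ‖z‖) * ∫⁻ x, f x := by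
    rw [← lintegral_const_mul _ hf]
    refine lintegral_congr fun x => ?_
    rw [lintegral_mul_const _ (by fun_prop),
      lintegral_sub_left_eq_self (fun z : Space d => g ‖z‖) x]
  have h2 : ∫⁻ x, ∫⁻ y, g ‖x - y‖ * f y = (∫⁻ z : Space d, g ‖z‖) * ∫⁻ x, f x := by
    rw [← h1, lintegral_lintegral_swap (by fun_prop)]
    simp only [norm_sub_rev]
  rw [two_mul]
  nth_rw 1 [← h1]
  rw [← h2, ← lintegral_add_left (Measurable.lintegral_prod_right
    (f := fun x y => g ‖x - y‖ * f x) (by fun_prop))]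
  refine lintegral_congr fun x => ?_
  rw [← lintegral_add_left (by fun_prop)]
  simp only [mul_add]

theorem differenceEnergy_add_kernelForm {g : ℝ → ℝ≥0∞} (hg : Measurable g) {φ : Space d → ℂ}
    (hφ : Measurable φ) :
    differenceEnergy g φ + 2 * kernelForm g (fun x => ‖φ x‖ₑ) (fun x => ‖φ x‖ₑ) =
      ∫⁻ x, ∫⁻ y, g ‖x - y‖ * (‖φ x - φ y‖ₑ ^ 2 + 2 * (‖φ x‖ₑ * ‖φ y‖ₑ)) := by
  have hm : Measurable fun x => ∫⁻ y, g ‖x - y‖ * ‖φ x - φ y‖ₑ ^ 2 :=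
    Measurable.lintegral_prod_right (f := fun x y => g ‖x - y‖ * ‖φ x - φ y‖ₑ ^ 2) (by fun_prop)
  have hm2 : Measurable fun x => ∫⁻ y, ‖φ x‖ₑ * ‖φ y‖ₑ * g ‖x - y‖ :=
    Measurable.lintegral_prod_right (f := fun x y => ‖φ x‖ₑ * ‖φ y‖ₑ * g ‖x - y‖) (by fun_prop)
  rw [differenceEnergy, kernelForm, ← lintegral_const_mul _ hm2, ← lintegral_add_left hm]
  refine lintegral_congr fun x => ?_
  rw [← lintegral_const_mul _ (by fun_prop), ← lintegral_add_left (by fun_prop)]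
  refine lintegral_congr fun y => ?_
  ring

theorem le_differenceEnergy_add_kernelForm {g : ℝ → ℝ≥0∞} (hg : Measurable g) {φ : Space d → ℂ}
    (hφ : Measurable φ) : 2 * ((∫⁻ z : Space d, g ‖z‖) * ∫⁻ x, ‖φ x‖ₑ ^ 2) ≤
      differenceEnergy g φ + 2 * kernelForm g (fun x => ‖φ x‖ₑ) (fun x => ‖φ x‖ₑ) := by
  rw [differenceEnergy_add_kernelForm hg hφ,
    ← lintegral_lintegral_kernel_mul_add hg (hφ.enorm.pow_const 2)]
  exact lintegral_mono fun x => lintegral_mono fun y => mul_le_mul_right (enorm_sq_add_le _ _) _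

theorem symmRearrFun_energy_identity {g : ℝ → ℝ≥0∞} (hg : Measurable g) (φ : Space d → ℂ) :
    differenceEnergy g (symmRearrFun φ) + 2 * kernelForm g (fun x => ‖symmRearrFun φ x‖ₑ)
      (fun x => ‖symmRearrFun φ x‖ₑ) =
      2 * ((∫⁻ z : Space d, g ‖z‖) * ∫⁻ x, ‖symmRearrFun φ x‖ₑ ^ 2) := by
  have hm := measurable_symmRearrFun φ
  rw [differenceEnergy_add_kernelForm hg hm,
    ← lintegral_lintegral_kernel_mul_add hg (hm.enorm.pow_const 2)]
  refine lintegral_congr fun x => lintegral_congr fun y => ?_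
  simp only [symmRearrFun]
  rw [enorm_sq_add_eq ENNReal.toReal_nonneg ENNReal.toReal_nonneg]

theorem differenceEnergy_symmRearrFun_le (hd : 1 ≤ d) {g : ℝ → ℝ≥0∞} (hg : Measurable g)
    (hanti : ∀ ⦃r r' : ℝ⦄, 0 ≤ r → r ≤ r' → g r' ≤ g r) (hgt : ∫⁻ z : Space d, g ‖z‖ ≠ ∞)
    {φ : Space d → ℂ} (hφ : Measurable φ) (h2 : ∫⁻ x, ‖φ x‖ₑ ^ 2 ≠ ∞) :
    differenceEnergy g (symmRearrFun φ) ≤ differenceEnergy g φ := by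
  have hid := symmRearrFun_energy_identity hg φ
  rw [lintegral_symmRearrFun_sq hd hφ h2] at hid
  have hle := le_differenceEnergy_add_kernelForm hg hφ
  have hk : kernelForm g (fun x => ‖φ x‖ₑ) (fun x => ‖φ x‖ₑ) ≤
      kernelForm g (fun x => ‖symmRearrFun φ x‖ₑ) (fun x => ‖symmRearrFun φ x‖ₑ) := by
    have h := enorm_symmRearrFun hd hφ h2
    rw [kernelForm_congr_ae h h]
    exact kernelForm_le_symmRearr hd hg hanti hgt hφ h2
  -- The energy identity bounds the cross term by the finite diagonal term, so it can be cancelled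
  -- in `[0, ∞]`.
  have hfin : 2 * kernelForm g (fun x => ‖symmRearrFun φ x‖ₑ)
      (fun x => ‖symmRearrFun φ x‖ₑ) ≠ ∞ :=
    ne_top_of_le_ne_top (ENNReal.mul_ne_top ENNReal.ofNat_ne_top (ENNReal.mul_ne_top hgt h2))
      (le_add_self.trans_eq hid)
  refine ENNReal.le_of_add_le_add_right hfin ?_
  rw [hid]
  exact hle.trans (by gcongr)

theorem heatEnergy_symmRearrFun_le (hd : 1 ≤ d) (φ : L2 d) (hφ : MemLp (symmRearrFun φ) 2) {t : ℝ}
    (ht : 0 < t) : heatEnergy t (hφ.toLp (symmRearrFun φ)) ≤ heatEnergy t φ := by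
  -- The kernel parameter `b = π²/t` corresponds to heat time `π²/b = t`.
  have hb : 0 < Real.pi ^ 2 / t := by positivity
  have h1 := differenceEnergy_gaussKernel hb φ
  have h2 := differenceEnergy_gaussKernel hb (hφ.toLp (symmRearrFun φ))
  rw [differenceEnergy_congr_ae hφ.coeFn_toLp] at h2
  have e : Real.pi ^ 2 / (Real.pi ^ 2 / t) = t := div_div_cancel₀ (by positivity)
  have h3 := differenceEnergy_symmRearrFun_le hd (measurable_gaussKernel (Real.pi ^ 2 / t))
    (fun r r' hr h => gaussKernel_anti hb.le hr h)
    (by rw [lintegral_gaussKernel hb]; exact ENNReal.ofReal_ne_top)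
    (Lp.stronglyMeasurable φ).measurable
    (by rw [lintegral_enorm_sq_eq]; exact ENNReal.pow_ne_top enorm_ne_top)
  rw [h1, h2, e] at h3
  refine (ENNReal.mul_le_mul_iff_right ?_ ENNReal.ofReal_ne_top).1 h3
  rw [Ne, ENNReal.ofReal_eq_zero, not_le]
  positivity

theorem homogeneousEnergy_symmRearrFun_le (hd : 1 ≤ d) {s : ℝ} (hs : 0 ≤ s) (hs1 : s ≤ 1)
    (φ : L2 d) (hφ : MemLp (symmRearrFun φ) 2)
    (heq : ∫⁻ x, ‖hφ.toLp (symmRearrFun φ) x‖ₑ ^ 2 = ∫⁻ x, ‖φ x‖ₑ ^ 2) :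
    homogeneousEnergy s (hφ.toLp (symmRearrFun φ)) ≤ homogeneousEnergy s φ := by
  have h : ∀ t > 0, heatEnergy t (hφ.toLp (symmRearrFun φ)) ≤ heatEnergy t φ :=
    fun t ht => heatEnergy_symmRearrFun_le hd φ hφ ht
  rcases hs.eq_or_lt with rfl | hs
  · rw [homogeneousEnergy_zero, homogeneousEnergy_zero, heq]
  rcases hs1.eq_or_lt with rfl | hs1
  · exact homogeneousEnergy_one_le_of_heatEnergy_le h
  · exact homogeneousEnergy_le_of_heatEnergy_le hs hs1 h

theorem sobolevNorm_le_of_energy_le {s : ℝ} (hs : 0 ≤ s) (hs1 : s ≤ 1) {f φ : L2 d}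
    (heq : ∫⁻ x, ‖f x‖ₑ ^ 2 = ∫⁻ x, ‖φ x‖ₑ ^ 2)
    (hle : homogeneousEnergy s f ≤ homogeneousEnergy s φ) :
    sobolevNorm s f ≤ ((if s = 1 then 1 else 2 : ℝ≥0) : ℝ≥0∞) * sobolevNorm s φ := by
  rw [← ENNReal.pow_le_pow_left_iff two_ne_zero]
  split_ifs with h
  · subst h
    rw [ENNReal.coe_one, one_mul, sobolevNorm_one_sq, sobolevNorm_one_sq, heq]
    gcongr
  · calc sobolevNorm s f ^ 2 ≤ (∫⁻ x, ‖f x‖ₑ ^ 2) + homogeneousEnergy s f :=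
          sobolevNorm_sq_le hs hs1 f
      _ ≤ (∫⁻ x, ‖φ x‖ₑ ^ 2) + homogeneousEnergy s φ := by rw [heq]; gcongr
      _ ≤ 2 * sobolevNorm s φ ^ 2 := add_homogeneousEnergy_le hs φ
      _ ≤ _ := by
          rw [mul_pow]
          gcongr
          -- The squared norms compare with factor `2`, so `√2` would suffice; the constant `2` is
          -- used through `2 ≤ 2 * 2`.
          rw [sq]
          exact le_mul_of_one_le_right' (by norm_num)

end Energy

end Rearrangement

theorem mainTheorem4 :
    ∃ C : ℝ → ℝ≥0, C 1 = 1 ∧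
      ∀ (d : ℕ), 1 ≤ d → ∀ (s : ℝ), 0 ≤ s → s ≤ 1 →
        ∀ φ : Rearrangement.L2 d, Rearrangement.MemSobolevSpace s φ →
          ∃ hφ : MemLp (Rearrangement.symmRearrFun φ) 2,
            Rearrangement.MemSobolevSpace s (hφ.toLp (Rearrangement.symmRearrFun φ)) ∧
            Rearrangement.sobolevNorm s (hφ.toLp (Rearrangement.symmRearrFun φ)) ≤
              C s * Rearrangement.sobolevNorm s φ ∧
            Rearrangement.homogeneousEnergy s (hφ.toLp (Rearrangement.symmRearrFun φ)) ≤
              Rearrangement.homogeneousEnergy s φ := by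
  refine ⟨fun s => if s = 1 then 1 else 2, if_pos rfl, fun d hd s hs hs1 φ hmem => ?_⟩
  have hm : Measurable φ := (Lp.stronglyMeasurable φ).measurable
  have h2 : ∫⁻ x, ‖φ x‖ₑ ^ 2 ≠ ∞ := by
    rw [Rearrangement.lintegral_enorm_sq_eq]; exact ENNReal.pow_ne_top enorm_ne_top
  have hφ := Rearrangement.memLp_symmRearrFun hd hm h2
  have heq : ∫⁻ x, ‖hφ.toLp (Rearrangement.symmRearrFun φ) x‖ₑ ^ 2 = ∫⁻ x, ‖φ x‖ₑ ^ 2 := by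
    rw [← Rearrangement.lintegral_symmRearrFun_sq hd hm h2]
    refine lintegral_congr_ae ?_
    filter_upwards [hφ.coeFn_toLp] with x hx
    rw [hx]
  have hle := Rearrangement.homogeneousEnergy_symmRearrFun_le hd hs hs1 φ hφ heq
  have hnorm := Rearrangement.sobolevNorm_le_of_energy_le hs hs1 heq hle
  exact ⟨hφ, hnorm.trans_lt (ENNReal.mul_lt_top ENNReal.coe_lt_top hmem), hnorm, hle⟩
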